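/- **Setting.** Let $G=\mathrm{PSL}_2(\mathbb R)$ act on $\mathbb H$ by fractional linear transformations, $p:G\to\mathbb H$, $p(g)=g.i$, and $a_t=\mathrm{diag}(e^{t/2},e^{-t/2})$. Let $\mu$ be the hyperbolic area $dx\,dy/y^2$ and $\mu_G$ the Haar measure on $G$ with $p_*\mu_G=\mu$. Let $\Gamma\le G$ be discrete and cofinite, $\pi_\Gamma:\mathbb H\to Y_\Gamma=\Gamma\backslash\mathbb H$ the projection, $\mathrm{vol}(\Gamma)=\mu(Y_\Gamma)$. Let $\mathcal F\subset\mathbb H$ be a fundamental polygon for $\Gamma$: a non-empty, open, connected, hyperbolically convex set whose boundary $\partial\mathcal F\subset\mathbb H$ is a finite union of geodesic segments, such that every $z\in\mathbb H$ is $\Gamma$-equivalent to a point of $\overline{\mathcal F}$, and $\Gamma$-equivalent points $z_1,z_2\in\overline{\mathcal F}$ satisfy $z_1=z_2$ or $z_1,z_2\in\partial\mathcal F$. **Geodesics.** An oriented closed geodesic $\mathcal C$ is a compact orbit $\{\Gamma g a_t\}$ in $\Gamma\backslash G$; $|\mathcal C|$ is its least period and $\mu_{\mathcal C}$ the $a_t$-invariant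 measure on it of mass $|\mathcal C|$. Finite collections $\mathbf C_1,\mathbf C_2,\dots$ of oriented closed geodesics, with $|\mathbf C|=\sum_{\mathcal C\in\mathbf C}|\mathcal C|$, *equidistribute in $\Gamma\backslash G$* if $\frac1{|\mathbf C_n|}\sum_{\mathcal C\in\mathbf C_n}\mu_{\mathcal C}(\Psi)\to\frac1{\mathrm{vol}(\Gamma)}\int_{\Gamma\backslash G}\Psi\,d\mu_G$ for all $\Psi\in C_c^\infty(\Gamma\backslash G)$. **Partial coverings.** Let $t\mapsto p(ga_t)$ be a lift of $\mathcal C$ and $\tilde B$ the closed half-plane to its left. Let $\gamma_1,\gamma_2,\ldots\in\Gamma$ be the elements for which the lift meets $\gamma_i\mathcal F$, one for each class modulo the element of $\Gamma$ translating the lift by $|\mathcal C|$. Put $\mathcal P(\mathcal C,\mathcal F)(x)=\sum_i\#(\pi_\Gamma^{-1}(x)\cap\tilde B\cap\gamma_i\mathcal F)$ for $x\in Y_\Gamma$, $\mathcal P(\mathbf C,\mathcal F)=\sum_{\mathcal C\in\mathbf C}\mathcal P(\mathcal C,\mathcal F)$ and $\mathrm{vol}(\mathcal P)=\int_{Y_\Gamma}\mathcal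 P\,d\mu$. **The constant.** For disjoint, non-empty, connected, relatively open $I,J\subset\partial\mathcal F$ let $\mathcal G(I,J)$ be the set of $g\in G$ for which there are $\ell_1,\ell_2>0$ with $p(ga_{-\ell_1})\in I$ and $p(ga_{\ell_2})\in J$. Let $c_{I,J}=\mu_G(\mathcal G(I,J))/(\mathrm{vol}(\Gamma)\,L)$, where $L$ is the supremum of $\ell_1+\ell_2$ over all such $g,\ell_1,\ell_2$ ($c_{I,J}=0$ if $L=\infty$ or $\mathcal G(I,J)=\emptyset$). Let $d_{I,J}=\mu(B\cap\mathcal F)$, where $B$ is the closed half-plane to the left of the oriented geodesic from $z_0$ to $z_1$, with $z_0$ an endpoint of $I$ and $z_1$ an endpoint of $J$ such that the part of $\partial\mathcal F$ strictly to the left of this geodesic is disjoint from $I\cup J$ (the supremum over such pairs $z_0\ne z_1$, and $d_{I,J}=0$ if there is none). Put $c(\Gamma,\mathcal F)=\sup_{I,J}c_{I,J}\,d_{I,J}$. **Proposition.** We have $c(\Gamma,\mathcal F)>0$, and if $\mathbf C_1,\mathbf C_2,\dots$ equidistribute in $\Gamma\backslash G$, then $$\mathrm{vol}(\mathcal P(\mathbf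 C_n,\mathcal F))\ \ge\ (c(\Gamma,\mathcal F)+o(1))\,|\mathbf C_n|,\qquad n\to\infty,$$ that is, there are $b_n\in[0,\infty]$ with $b_n\to c(\Gamma,\mathcal F)$ and $\mathrm{vol}(\mathcal P(\mathbf C_n,\mathcal F))\ge b_n|\mathbf C_n|$ for all $n$. -/

import Mathlib

open MeasureTheory Filter Topology Set
open scoped UpperHalfPlane MatrixGroups Pointwise ContDiff ENNReal

noncomputable section

namespace PaintLeft

/-! ### The group `PSL(2, ℝ)`, its action on the hyperbolic plane, and its Haar measure -/

/-- The group `G = PSL(2, ℝ)`, with the quotient topology from `SL(2, ℝ)`. -/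
abbrev G : Type := PSL(2, ℝ)

/-- The projection `SL(2, ℝ) → PSL(2, ℝ)`. -/
def toG (A : SL(2, ℝ)) : G := QuotientGroup.mk A

/-- The centre of `SL(2, ℝ)` acts trivially on the upper half-plane. -/
theorem center_le_ker :
    Subgroup.center SL(2, ℝ) ≤ (MulAction.toPermHom SL(2, ℝ) ℍ).ker := by
  intro A hA
  rw [MonoidHom.mem_ker]
  ext1 z
  obtain ⟨r, hr, hrA⟩ := Matrix.SpecialLinearGroup.mem_center_iff.mp hA
  have hr0 : r ≠ 0 := by
    rintro rfl
    simp at hr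
  have h00 : A 0 0 = r := by
    simpa using (congrFun (congrFun hrA 0) 0).symm
  have h11 : A 1 1 = r := by
    simpa using (congrFun (congrFun hrA 1) 1).symm
  have h01 : A 0 1 = 0 := by
    simpa using (congrFun (congrFun hrA 0) 1).symm
  have h10 : A 1 0 = 0 := by
    simpa using (congrFun (congrFun hrA 1) 0).symm
  simp only [MulAction.toPermHom_apply, Equiv.Perm.coe_one, id_eq, MulAction.toPerm_apply]
  ext1
  rw [UpperHalfPlane.coe_specialLinearGroup_apply]
  have hrC : (r : ℂ) ≠ 0 := by exact_mod_cast hr0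
  simp [h00, h11, h01, h10, hrC]

/-- `PSL(2, ℝ)` acts on `ℍ` by linear fractional transformations. -/
instance instMulActionG : MulAction G ℍ :=
  MulAction.compHom ℍ
    (QuotientGroup.lift (Subgroup.center SL(2, ℝ)) (MulAction.toPermHom SL(2, ℝ) ℍ)
      center_le_ker)

theorem toG_smul (A : SL(2, ℝ)) (z : ℍ) : toG A • z = A • z := rfl

instance instMeasurableSpaceG : MeasurableSpace G := borel G

instance instBorelSpaceG : BorelSpace G := ⟨rfl⟩

/-- The projection `p : G → G / PSO(2) = ℍ`, `g ↦ g • i`. -/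
def p (g : G) : ℍ := g • UpperHalfPlane.I

/-- The diagonal matrix `diag (e^{t/2}, e^{-t/2})`. -/
def diagSL (t : ℝ) : SL(2, ℝ) :=
  ⟨!![Real.exp (t / 2), 0; 0, Real.exp (-t / 2)], by
    rw [Matrix.det_fin_two_of, ← Real.exp_add]; ring_nf; simp⟩

/-- The diagonal element `a_t` of `G`. Right multiplication by `a_t` is the geodesic flow:
`t ↦ p (g * a t)` is the oriented unit speed geodesic with initial frame `g`. -/
def a (t : ℝ) : G := toG (diagSL t)

/-- The rotation by `θ`; its image in `G` has period `π`. -/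
def rot (θ : ℝ) : SL(2, ℝ) :=
  ⟨!![Real.cos θ, Real.sin θ; -Real.sin θ, Real.cos θ], by
    rw [Matrix.det_fin_two_of]; linarith [Real.sin_sq_add_cos_sq θ]⟩

/-- Iwasawa coordinates on `G`: for `z = x + i y`, the element
`(1, x; 0, 1) * diag (√y, 1/√y) * rot θ`. -/
def iwasawa (z : ℍ) (θ : ℝ) : G := toG (z.toSL2R * rot θ)

/-- The Haar measure of `G`, in Iwasawa coordinates `(dx dy / y²) (dθ / π)` with `θ ∈ (0, π]`, so
normalized that its push-forward under `p` is the hyperbolic area `dx dy / y²`. -/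
def haarG : Measure G :=
  ((volume : Measure ℍ).prod
    ((ENNReal.ofReal Real.pi)⁻¹ • (volume : Measure ℝ).restrict (Ioc 0 Real.pi))).map
    (fun q : ℍ × ℝ => iwasawa q.1 q.2)

/-- A function on `G` is smooth if it is smooth in the coordinates `(x, u, θ)`, `z = x + i e^u`
(these define a smooth covering map `ℝ³ → G`). -/
def SmoothOnG (f : G → ℂ) : Prop :=
  ContDiff ℝ ∞ (fun v : ℝ × ℝ × ℝ =>
    f (iwasawa ⟨⟨v.1, Real.exp v.2.1⟩, Real.exp_pos v.2.1⟩ v.2.2))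

/-! ### Fundamental polygons -/

/-- A geodesic segment (bounded or not): the image of an interval under a unit speed geodesic. -/
def IsGeodesicSegment (s : Set ℍ) : Prop :=
  ∃ (g : G) (T : Set ℝ), T.OrdConnected ∧ s = (fun t => p (g * a t)) '' T

/-- `F` is a fundamental polygon for `Γ`: a convex fundamental domain whose boundary (in `ℍ`)
consists of finitely many geodesic segments. -/
structure IsFundamentalPolygon (Γ : Subgroup G) (F : Set ℍ) : Prop where
  isOpen : IsOpen F
  isConnected : IsConnected F
  covers : ∀ z : ℍ, ∃ γ ∈ Γ, γ • z ∈ closure F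
  boundary_of_equiv : ∀ γ ∈ Γ, ∀ z ∈ closure F, γ • z ∈ closure F →
    z = γ • z ∨ (z ∈ frontier F ∧ γ • z ∈ frontier F)
  /-- hyperbolic convexity: `F` meets every geodesic in an interval -/
  convex : ∀ g : G, {t : ℝ | p (g * a t) ∈ F}.OrdConnected
  finite_boundary : ∃ S : Set (Set ℍ), S.Finite ∧ (∀ s ∈ S, IsGeodesicSegment s) ∧
    frontier F = ⋃₀ S

/-- `Γ` is cofinite: it has a fundamental domain of finite hyperbolic area. -/
def IsCofinite (Γ : Subgroup G) : Prop :=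
  ∃ D : Set ℍ, IsFundamentalDomain Γ D (volume : Measure ℍ) ∧ volume D < ⊤

/-- The hyperbolic orbifold `Y_Γ = Γ \ ℍ`. -/
abbrev Orbifold (Γ : Subgroup G) : Type := MulAction.orbitRel.Quotient Γ ℍ

/-- The unit tangent bundle `Γ \ G`. -/
abbrev UnitTangent (Γ : Subgroup G) : Type := MulAction.orbitRel.Quotient Γ G

/-- The projection `π_Γ : ℍ → Γ \ ℍ`. -/
def projY (Γ : Subgroup G) (z : ℍ) : Orbifold Γ := Quotient.mk _ z

/-- The projection `G → Γ \ G`. -/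
def projT (Γ : Subgroup G) (g : G) : UnitTangent Γ := Quotient.mk _ g

/-- The hyperbolic area measure on `Γ \ ℍ`, computed on the fundamental domain `F` (it does not
depend on the choice of `F`). -/
def areaY (Γ : Subgroup G) (F : Set ℍ) : Measure (Orbifold Γ) :=
  ((volume : Measure ℍ).restrict F).map (projY Γ)

/-- The Haar measure on `Γ \ G`, computed on the fundamental domain `p⁻¹(F)` (it does not depend
on the choice of `F`). -/
def haarT (Γ : Subgroup G) (F : Set ℍ) : Measure (UnitTangent Γ) :=
  (haarG.restrict (p ⁻¹' F)).map (projT Γ)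

/-- `vol(Γ)`, the area of `Γ \ ℍ`. -/
def vol (Γ : Subgroup G) (F : Set ℍ) : ℝ≥0∞ := areaY Γ F univ

/-! ### Oriented closed geodesics and equidistribution -/

/-- An oriented closed geodesic on `Γ \ ℍ`, i.e. a compact orbit `{Γ g a_t}` of the geodesic flow
on `Γ \ G`, presented by one of its frames `g`. All notions below depend only on the orbit. -/
structure ClosedGeodesic (Γ : Subgroup G) where
  /-- a frame on a lift of the geodesic -/
  frame : G
  closed : ∃ t : ℝ, 0 < t ∧ frame * a t * frame⁻¹ ∈ Γ

variable {Γ : Subgroup G}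

/-- The length `|C|`: the least positive period. -/
def ClosedGeodesic.length (C : ClosedGeodesic Γ) : ℝ :=
  sInf {t : ℝ | 0 < t ∧ C.frame * a t * C.frame⁻¹ ∈ Γ}

/-- The flow-invariant measure `μ_C` of total mass `|C|` on the orbit `C ⊆ Γ \ G`. -/
def ClosedGeodesic.measure (C : ClosedGeodesic Γ) : Measure (UnitTangent Γ) :=
  ((volume : Measure ℝ).restrict (Ioc 0 C.length)).map (fun t => projT Γ (C.frame * a t))

/-- The total length of a finite collection of closed geodesics. -/
def totalLength (S : Multiset (ClosedGeodesic Γ)) : ℝ := (S.map ClosedGeodesic.length).sum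

/-- Equidistribution of a sequence of finite collections of oriented closed geodesics in the unit
tangent bundle. -/
def Equidistribute (F : Set ℍ) (S : ℕ → Multiset (ClosedGeodesic Γ)) : Prop :=
  ∀ Ψ : UnitTangent Γ → ℂ, SmoothOnG (fun g => Ψ (projT Γ g)) → HasCompactSupport Ψ →
    Tendsto (fun n => ((S n).map (fun C => ∫ x, Ψ x ∂C.measure)).sum / (totalLength (S n) : ℂ))
      atTop (𝓝 ((∫ x, Ψ x ∂(haarT Γ F)) / ((vol Γ F).toReal : ℂ)))

/-! ### Partial coverings -/

/-- The closed half-plane to the left of the oriented geodesic `t ↦ p (g * a t)`; this is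
`σ⁻¹ {Re z ≥ 0}` when `σ` sends the starting point of the geodesic to `∞` and its end point to `0`
(take `σ = (0, -1; 1, 0) * g⁻¹`). -/
def leftSide (g : G) : Set ℍ := {z | (g⁻¹ • z).re ≤ 0}

/-- The geodesic `t ↦ p (g * a t)` enters the open set `T` at time `s`. A geodesic that meets a
convex open set without being there from the beginning enters it exactly once. -/
def EntersAt (g : G) (s : ℝ) (T : Set ℍ) : Prop :=
  p (g * a s) ∉ T ∧ ∀ᶠ t in 𝓝[>] s, p (g * a t) ∈ T

/-- The `γ ∈ Γ` for which `γ F` is entered by the lift of `C` during one period. So every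
`Γ`-translate of `F` crossed by the lift is counted once modulo the element of `Γ` that translates
the lift by one period; there is none if `C` runs inside the image of the boundary of `F`. -/
def ClosedGeodesic.tiles (C : ClosedGeodesic Γ) (F : Set ℍ) : Set G :=
  {γ | γ ∈ Γ ∧ ∃ s ∈ Ico 0 C.length, EntersAt C.frame s (γ • F)}

/-- The partial covering `P(C, F)` of `Γ \ ℍ`: the sum over the translates `γ F` crossed by the
lift of the counting functions `x ↦ #(π_Γ⁻¹(x) ∩ P_γ)`, where `P_γ` is the part of `γ F` to the
left of the lift. -/
def partialCovering (F : Set ℍ) (C : ClosedGeodesic Γ) (x : Orbifold Γ) : ℝ≥0∞ :=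
  ∑' γ : C.tiles F,
    ((projY Γ ⁻¹' {x} ∩ (leftSide C.frame ∩ (γ : G) • F)).encard : ℝ≥0∞)

/-- The volume of the partial covering associated with a finite collection of closed geodesics. -/
def volCovering (F : Set ℍ) (S : Multiset (ClosedGeodesic Γ)) : ℝ≥0∞ :=
  ∫⁻ x, (S.map (fun C => partialCovering F C x)).sum ∂(areaY Γ F)

/-! ### The geometric constant of the polygon -/

/-- A non-empty, connected, (relatively) open subsegment of the boundary of `F`. -/
def IsBoundaryArc (F I : Set ℍ) : Prop :=
  I ⊆ frontier F ∧ IsConnected I ∧ ∃ U : Set ℍ, IsOpen U ∧ I = U ∩ frontier F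

/-- The set `𝒢(I, J)` of frames whose geodesic came from `I` and goes to `J`. -/
def crossing (I J : Set ℍ) : Set G :=
  {g | ∃ l₁ > 0, ∃ l₂ > 0, p (g * a (-l₁)) ∈ I ∧ p (g * a l₂) ∈ J}

/-- The supremum of the lengths `ℓ_I(g) + ℓ_J(g)` over `g ∈ 𝒢(I, J)`. -/
def maxCrossingLength (I J : Set ℍ) : ℝ≥0∞ :=
  ⨆ (g : G) (l₁ : ℝ) (l₂ : ℝ) (_ : 0 < l₁ ∧ 0 < l₂ ∧ p (g * a (-l₁)) ∈ I ∧ p (g * a l₂) ∈ J),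
    ENNReal.ofReal (l₁ + l₂)

/-- `c_{I,J}`: the measure of `𝒢(I, J)`, for the Haar measure normalized to be a probability
measure on `Γ \ G`, divided by the largest crossing length (zero if that is infinite). -/
def crossConst (Γ : Subgroup G) (F I J : Set ℍ) : ℝ≥0∞ :=
  (haarG (crossing I J) / vol Γ F) / maxCrossingLength I J

/-- The oriented geodesic with initial frame `g` leads from an endpoint `z₀` of `I` to an
endpoint `z₁` of `J` such that the part of the boundary of `F` between `z₀` and `z₁`, strictly to
the left of the geodesic, is disjoint from `I` and `J`. -/
def IsGapChord (F I J : Set ℍ) (g : G) : Prop :=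
  p g ∈ closure I \ I ∧ (∃ t > 0, p (g * a t) ∈ closure J \ J) ∧
    Disjoint (frontier F ∩ {z | (g⁻¹ • z).re < 0}) (I ∪ J)

/-- `d_{I,J}`: the area of the polygon cut off from `F`, on the left, by the oriented geodesic
through the endpoints of the gap between `I` and `J`; it is zero if the gap is degenerate. -/
def gapArea (F I J : Set ℍ) : ℝ≥0∞ :=
  ⨆ (g : G) (_ : IsGapChord F I J g), volume (leftSide g ∩ F)

/-- `c(Γ, F)`: the supremum of `c_{I,J} * d_{I,J}` over disjoint boundary arcs `I, J` of `F`. -/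
def geomConst (Γ : Subgroup G) (F : Set ℍ) : ℝ≥0∞ :=
  ⨆ (I : Set ℍ) (J : Set ℍ) (_ : IsBoundaryArc F I ∧ IsBoundaryArc F J ∧ Disjoint I J),
    crossConst Γ F I J * gapArea F I J

end PaintLeft

end

/-!
# Equidistributed closed geodesics cover a positive proportion on their left

The lower bound comes from counting the crossings of `F` between two disjoint boundary arcs `I` and
`J`. In the Klein model (`klein`) geodesics are straight and the polygon is a convex open set of the
plane. A chord from an endpoint of `I` to an endpoint of `J` with both arcs on its right cuts off a
cap of the polygon, and this cap lies to the left of every geodesic that crosses the polygon from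
`I` to `J` (`cap_subset_left_of_chord`, `leftSide_gapChord_subset`). So whenever a lift of a closed
geodesic passes through `γ F` from `γ I` to `γ J`, the translate contributes at least
`gapArea F I J` to the volume of the partial covering, while the crossing takes at most the time
`maxCrossingLength I J`. Summing over the translates crossed in one period bounds the covered volume
below by the quotient of these constants times the total crossing time
(`gapArea_mul_crossingTimes_le`).

The crossing time is controlled by equidistribution. The frames over `F` that cross from `I` to `J`
form an open set `innerCrossing F I J`, which differs from `crossing I J` by a null set
(`haarG_crossing`). A smooth function with compact support in this set, of integral close to its Haar
measure, descends to a test function on `Γ \ G` by summation over `Γ` (`exists_testFunction`; the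
bump functions come from the matrix entries, which are smooth in Iwasawa coordinates). Hence the
proportion of time spent in crossings is asymptotically at least the normalized Haar measure
(`eventually_crossingTimes`), and the supremum over `I` and `J` gives the constant. The minimum of the
constant and of the actual ratio serves as `b n` (`exists_tendsto_geomConst`).

For positivity one pair of arcs with a positive contribution suffices. Since `Γ` is cofinite, `F` has
finite area. Therefore two boundary points exist whose connecting segment meets `F` (`exists_chord`):
otherwise the boundary would be convex, hence contained in a geodesic, and `F` would contain a
half-plane, whose area is infinite. From a point of `F` on this segment, the boundary points seen in
two thin opposite sectors around the directions of the end points form arcs `I` and `J`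
(`sectorArc`). They lie in compact sets, so `maxCrossingLength I J` is finite
(`maxCrossingLength_ne_top`); the chord between their end points on the left leaves both arcs on its
right (`sectorArc_gap`) and cuts off a cap of positive area; and the crossing frames contain a
non-empty open set (`geomConst_pos`).
-/

namespace PaintLeft

/-! ### The group `PSL(2, ℝ)` and its action -/

theorem toG_surjective : Function.Surjective toG := QuotientGroup.mk_surjective

theorem toG_mul (A B : SL(2, ℝ)) : toG (A * B) = toG A * toG B := rfl

theorem toG_inv (A : SL(2, ℝ)) : toG A⁻¹ = (toG A)⁻¹ := rfl

theorem toG_one : toG 1 = 1 := rfl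

theorem continuous_toG : Continuous toG := QuotientGroup.continuous_mk

theorem isOpenMap_toG : IsOpenMap toG := QuotientGroup.isOpenMap_coe

instance instSecondCountableSL : SecondCountableTopology SL(2, ℝ) :=
  have : SecondCountableTopology (Matrix (Fin 2) (Fin 2) ℝ) :=
    inferInstanceAs (SecondCountableTopology (Fin 2 → Fin 2 → ℝ))
  (Matrix.SpecialLinearGroup.isClosedEmbedding_val (R := ℝ) (n := Fin 2)).isEmbedding.secondCountableTopology

instance instLocallyCompactMatrix : LocallyCompactSpace (Matrix (Fin 2) (Fin 2) ℝ) :=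
  inferInstanceAs (LocallyCompactSpace (Fin 2 → Fin 2 → ℝ))

instance instLocallyCompactSL : LocallyCompactSpace SL(2, ℝ) :=
  (Matrix.SpecialLinearGroup.isClosedEmbedding_val (R := ℝ) (n := Fin 2)).locallyCompactSpace

instance instSecondCountableG : SecondCountableTopology G :=
  inferInstanceAs (SecondCountableTopology (SL(2, ℝ) ⧸ Subgroup.center SL(2, ℝ)))

instance instLocallyCompactG : LocallyCompactSpace G :=
  inferInstanceAs (LocallyCompactSpace (SL(2, ℝ) ⧸ Subgroup.center SL(2, ℝ)))

instance instT2G : T2Space G := by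
  have : IsClosed (Subgroup.center SL(2, ℝ) : Set SL(2, ℝ)) := by
    have : (Subgroup.center SL(2, ℝ) : Set SL(2, ℝ)) = ⋂ B : SL(2, ℝ), {A | B * A = A * B} := by
      ext A
      simp [Subgroup.mem_center_iff]
    rw [this]
    exact isClosed_iInter fun B => isClosed_eq (by fun_prop) (by fun_prop)
  have : T3Space (SL(2, ℝ) ⧸ Subgroup.center SL(2, ℝ)) := inferInstance
  exact inferInstanceAs (T2Space (SL(2, ℝ) ⧸ Subgroup.center SL(2, ℝ)))

instance instContinuousSMulG : ContinuousSMul G ℍ where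
  continuous_smul := by
    have hq : IsOpenQuotientMap (Prod.map toG (id : ℍ → ℍ)) :=
      IsOpenQuotientMap.prodMap ⟨toG_surjective, continuous_toG, isOpenMap_toG⟩
        IsOpenQuotientMap.id
    rw [hq.isQuotientMap.continuous_iff]
    exact continuous_smul (M := SL(2, ℝ)) (X := ℍ)

theorem continuous_p : Continuous p := by unfold p; fun_prop

theorem p_mul (g h : G) : p (g * h) = g • p h := mul_smul _ _ _

theorem normSq_denom_pos (A : SL(2, ℝ)) (z : ℍ) :
    0 < (A 1 0 * z.re + A 1 1) ^ 2 + (A 1 0 * z.im) ^ 2 := by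
  by_cases hc : A 1 0 = 0
  · have hd : A 1 1 ≠ 0 := by
      intro hd
      have := A.det_coe
      rw [Matrix.det_fin_two] at this
      simp [hc, hd] at this
    simp only [hc, zero_mul, zero_add]
    positivity
  · have := z.im_pos
    positivity

theorem re_smul_SL (A : SL(2, ℝ)) (z : ℍ) :
    (A • z).re = ((A 0 0 * A 1 0) * (z.re ^ 2 + z.im ^ 2) +
      (A 0 0 * A 1 1 + A 0 1 * A 1 0) * z.re + A 0 1 * A 1 1) /
        ((A 1 0 * z.re + A 1 1) ^ 2 + (A 1 0 * z.im) ^ 2) := by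
  rw [← UpperHalfPlane.coe_re, UpperHalfPlane.coe_specialLinearGroup_apply]
  simp only [Complex.div_re, Complex.normSq_apply]
  simp
  ring

theorem im_smul_SL (A : SL(2, ℝ)) (z : ℍ) :
    (A • z).im = z.im / ((A 1 0 * z.re + A 1 1) ^ 2 + (A 1 0 * z.im) ^ 2) := by
  have hdet := A.det_coe
  rw [Matrix.det_fin_two] at hdet
  rw [← UpperHalfPlane.coe_im, UpperHalfPlane.coe_specialLinearGroup_apply]
  simp only [Complex.div_im, Complex.normSq_apply]
  simp
  rw [← sub_div, ← pow_two, ← pow_two]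
  congr 1
  linear_combination z.im * hdet

theorem SL_inv_entries (A : SL(2, ℝ)) :
    A⁻¹ 0 0 = A 1 1 ∧ A⁻¹ 0 1 = -A 0 1 ∧ A⁻¹ 1 0 = -A 1 0 ∧ A⁻¹ 1 1 = A 0 0 := by
  rw [Matrix.SpecialLinearGroup.SL2_inv_expl]
  simp

theorem re_a_smul (t : ℝ) (z : ℍ) : (a t • z).re = Real.exp t * z.re := by
  rw [a, toG_smul, re_smul_SL]
  have h : Real.exp t = Real.exp (t / 2) * Real.exp (t / 2) := by rw [← Real.exp_add]; ring_nf
  have := Real.exp_pos (t / 2)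
  simp [diagSL, neg_div, Real.exp_neg]
  rw [h]
  field_simp

theorem im_a_smul (t : ℝ) (z : ℍ) : (a t • z).im = Real.exp t * z.im := by
  rw [a, toG_smul, im_smul_SL]
  have h : Real.exp t = Real.exp (t / 2) * Real.exp (t / 2) := by rw [← Real.exp_add]; ring_nf
  have := Real.exp_pos (t / 2)
  simp [diagSL, neg_div, Real.exp_neg]
  rw [h]
  field_simp

theorem continuous_a : Continuous a := by
  refine continuous_toG.comp ?_
  refine continuous_induced_rng.mpr ?_
  refine continuous_matrix fun i j => ?_
  fin_cases i <;> fin_cases j <;> simp <;> fun_prop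

theorem a_add (s t : ℝ) : a (s + t) = a s * a t := by
  rw [a, a, a, ← toG_mul]
  congr 1
  apply Subtype.ext
  rw [Matrix.SpecialLinearGroup.coe_mul]
  simp [diagSL, add_div, Real.exp_add, mul_comm]

theorem a_zero : a 0 = 1 := by
  rw [a, ← toG_one]
  congr 1
  ext i j
  fin_cases i <;> fin_cases j <;> simp [diagSL]

theorem a_neg (t : ℝ) : a (-t) = (a t)⁻¹ := by
  rw [eq_inv_iff_mul_eq_one, ← a_add, neg_add_cancel, a_zero]

theorem re_p_a (t : ℝ) : (p (a t)).re = 0 := by simp [p, re_a_smul]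

theorem im_p_a (t : ℝ) : (p (a t)).im = Real.exp t := by simp [p, im_a_smul]

theorem toG_eq_one_iff (A : SL(2, ℝ)) :
    toG A = 1 ↔ A 0 1 = 0 ∧ A 1 0 = 0 ∧ A 0 0 = A 1 1 := by
  have h : toG A = 1 ↔ A ∈ Subgroup.center SL(2, ℝ) := QuotientGroup.eq_one_iff A
  rw [h, Matrix.SpecialLinearGroup.mem_center_iff]
  constructor
  · rintro ⟨r, -, hr⟩
    have h01 := congrFun (congrFun hr 0) 1
    have h10 := congrFun (congrFun hr 1) 0
    have h00 := congrFun (congrFun hr 0) 0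
    have h11 := congrFun (congrFun hr 1) 1
    simp at h01 h10 h00 h11
    exact ⟨h01.symm, h10.symm, h00 ▸ h11⟩
  · rintro ⟨h1, h2, h3⟩
    have hdet := A.det_coe
    rw [Matrix.det_fin_two] at hdet
    refine ⟨A 0 0, ?_, ?_⟩
    · rw [Fintype.card_fin]; rw [← h3, h1] at hdet; linear_combination hdet
    · ext i j
      fin_cases i <;> fin_cases j <;> simp [h1, h2, h3]

theorem toG_neg (A : SL(2, ℝ)) : toG (-A) = toG A := by
  have : toG (A⁻¹ * -A) = 1 := by
    rw [toG_eq_one_iff, mul_neg, inv_mul_cancel]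
    simp
  rw [toG_mul, toG_inv, inv_mul_eq_one] at this
  exact this.symm

theorem toG_eq_iff (A B : SL(2, ℝ)) : toG A = toG B ↔ A = B ∨ A = -B := by
  refine ⟨fun h => ?_, ?_⟩
  · have h1 : toG (B⁻¹ * A) = 1 := by rw [toG_mul, toG_inv, h, inv_mul_cancel]
    rw [toG_eq_one_iff] at h1
    obtain ⟨h01, h10, h00⟩ := h1
    have hdet := (B⁻¹ * A).det_coe
    rw [Matrix.det_fin_two, h01, ← h00, zero_mul, sub_zero] at hdet
    rcases mul_self_eq_one_iff.mp hdet with h | h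
    · left
      have : B⁻¹ * A = 1 := by
        ext i j
        fin_cases i <;> fin_cases j <;> simp_all
      rw [inv_mul_eq_one] at this
      exact this.symm
    · right
      have : B⁻¹ * A = -1 := by
        ext i j
        fin_cases i <;> fin_cases j <;> simp_all
      rw [inv_mul_eq_iff_eq_mul] at this
      rw [this, mul_neg, mul_one]
  · rintro (rfl | rfl)
    · rfl
    · exact toG_neg B

/-- An element of `PSL(2, ℝ)` fixing every point of a non-empty open set is trivial: a
non-trivial one has at most one fixed point. -/
theorem eq_one_of_fixes_open {g : G} {U : Set ℍ} (hU : IsOpen U) (hne : U.Nonempty)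
    (h : ∀ z ∈ U, g • z = z) : g = 1 := by
  obtain ⟨A, rfl⟩ := toG_surjective g
  obtain ⟨z, hz⟩ := hne
  -- The real and imaginary parts of the fixed point equation at `z` and at a second point `t + z`
  -- of `U` force `A = ± 1`.
  have key : ∀ w ∈ U, A 1 0 * (w.re ^ 2 - w.im ^ 2) + (A 1 1 - A 0 0) * w.re - A 0 1 = 0 ∧
      2 * A 1 0 * w.re + (A 1 1 - A 0 0) = 0 := by
    intro w hw
    have h1 := h w hw
    rw [toG_smul] at h1
    have h2 := congrArg UpperHalfPlane.coe h1
    rw [UpperHalfPlane.coe_specialLinearGroup_apply, div_eq_iff] at h2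
    · have hre := congrArg Complex.re h2
      have him := congrArg Complex.im h2
      simp at hre him
      have := w.im_pos
      constructor
      · linear_combination -hre
      · have h3 : w.im * (2 * A 1 0 * w.re + (A 1 1 - A 0 0)) = 0 := by linear_combination -him
        simpa [this.ne'] using h3
    · intro h0
      have hre := congrArg Complex.re h0
      have him := congrArg Complex.im h0
      simp at hre him
      have := normSq_denom_pos A w
      rw [hre] at this
      rcases him with h | h
      · simp [h] at this
      · exact w.im_ne_zero h
  have hcont : ContinuousAt (fun t : ℝ => t +ᵥ z) 0 := by
    have : Continuous (fun t : ℝ => t +ᵥ z) := by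
      rw [UpperHalfPlane.isEmbedding_coe.continuous_iff]
      simp only [Function.comp_def, UpperHalfPlane.coe_vadd]
      fun_prop
    exact this.continuousAt
  have hev : ∀ᶠ t : ℝ in 𝓝 0, t +ᵥ z ∈ U := hcont (by simpa using hU.mem_nhds hz)
  obtain ⟨t, ht, htU⟩ := ((hev.filter_mono nhdsWithin_le_nhds).and
    (self_mem_nhdsWithin : {0}ᶜ ∈ 𝓝[≠] (0:ℝ))).exists
  have k1 := key z hz
  have k2 := key _ ht
  simp only [UpperHalfPlane.vadd_re, UpperHalfPlane.vadd_im] at k2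
  have hc : A 1 0 = 0 := by
    have : t * A 1 0 = 0 := by linear_combination (k2.2 - k1.2) / 2
    simpa [show t ≠ 0 from htU] using this
  rw [toG_eq_one_iff]
  refine ⟨?_, hc, ?_⟩
  · linear_combination -k1.1 + hc * (-z.re^2 - z.im^2) + z.re * k1.2
  · linear_combination -k1.2 + 2 * z.re * hc

theorem smulInvariant_G (g : G) : MeasurePreserving (fun z : ℍ => g • z) volume volume := by
  obtain ⟨A, rfl⟩ := toG_surjective g
  exact measurePreserving_smul (Matrix.SpecialLinearGroup.toGL A) (volume : Measure ℍ)

instance instInvariantG : SMulInvariantMeasure G ℍ volume where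
  measure_preimage_smul g _ hs := (smulInvariant_G g).measure_preimage hs.nullMeasurableSet

instance instOpenPos : Measure.IsOpenPosMeasure (volume : Measure ℍ) where
  open_pos U hU hne := by
    rw [UpperHalfPlane.volume_def]
    intro h0
    rw [withDensity_apply_eq_zero'] at h0
    · have : {z : ℍ | ((((1 / NNReal.mk z.im z.im_pos.le) : NNReal) ^ 2 : NNReal) : ℝ≥0∞) ≠ 0} ∩ U = U := by
        refine inter_eq_right.mpr fun z _ => ?_
        have := z.im_pos.ne'
        simp only [mem_ofPred_eq, ne_eq, ENNReal.coe_eq_zero]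
        refine pow_ne_zero _ (one_div_ne_zero ?_)
        intro h
        exact this (congrArg NNReal.toReal h)
      rw [this, UpperHalfPlane.measurableEmbedding_coe.comap_apply] at h0
      exact ((UpperHalfPlane.isOpenEmbedding_coe.isOpenMap U hU).measure_ne_zero volume
        (hne.image _)) h0
    · refine Measurable.aemeasurable ?_
      refine Continuous.measurable ?_
      refine ENNReal.continuous_coe.comp ?_
      refine Continuous.pow (.div₀ continuous_const ?_ ?_) _
      · exact UpperHalfPlane.continuous_im.subtype_mk _
      · exact fun x ↦ NNReal.ne_iff.mp x.im_ne_zero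

/-! ### Convex open sets in the plane and their chords -/

/-- The orientation determinant `det (q - p, r - p)`: it is positive when `r` lies strictly to the
left of the oriented line from `p` to `q`. -/
def orient (p q r : ℝ × ℝ) : ℝ := (q.1 - p.1) * (r.2 - p.2) - (q.2 - p.2) * (r.1 - p.1)

theorem continuous_orient (p q : ℝ × ℝ) : Continuous (orient p q) := by
  unfold orient; fun_prop

theorem orient_lineMap (p q u v : ℝ × ℝ) (s : ℝ) :
    orient p q (AffineMap.lineMap u v s) = (1 - s) * orient p q u + s * orient p q v := by
  simp only [orient, AffineMap.lineMap_apply_module]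
  simp
  ring

@[simp] theorem orient_left (p q : ℝ × ℝ) : orient p q p = 0 := by simp [orient]

@[simp] theorem orient_right (p q : ℝ × ℝ) : orient p q q = 0 := by simp [orient]; ring

theorem orient_cycle (p q r : ℝ × ℝ) : orient q r p = orient p q r := by
  simp only [orient]; ring

theorem orient_swap (p q r : ℝ × ℝ) : orient q p r = -orient p q r := by
  simp only [orient]; ring

theorem exists_lineMap_of_orient_eq_zero {p q r : ℝ × ℝ} (hpq : p ≠ q) (h : orient p q r = 0) :
    ∃ s : ℝ, r = AffineMap.lineMap p q s := by
  simp only [orient] at h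
  by_cases h1 : q.1 - p.1 = 0
  · have h2 : q.2 - p.2 ≠ 0 := fun h2 => hpq (Prod.ext (by linarith) (by linarith))
    refine ⟨(r.2 - p.2) / (q.2 - p.2), Prod.ext ?_ ?_⟩
    · simp only [AffineMap.lineMap_apply_module', Prod.fst_add, Prod.smul_fst, Prod.fst_sub, h1]
      have : (q.2 - p.2) * (r.1 - p.1) = 0 := by rw [h1] at h; linarith
      rcases mul_eq_zero.mp this with h | h
      · exact absurd h h2
      · simp; linarith
    · simp only [AffineMap.lineMap_apply_module', Prod.snd_add, Prod.smul_snd, Prod.snd_sub,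
        smul_eq_mul]
      field_simp; ring
  · refine ⟨(r.1 - p.1) / (q.1 - p.1), Prod.ext ?_ ?_⟩
    · simp only [AffineMap.lineMap_apply_module', Prod.fst_add, Prod.smul_fst, Prod.fst_sub,
        smul_eq_mul]
      field_simp; ring
    · simp only [AffineMap.lineMap_apply_module', Prod.snd_add, Prod.smul_snd, Prod.snd_sub,
        smul_eq_mul]
      field_simp
      linarith

theorem lineMap_mem_openSegment {p q : ℝ × ℝ} {s : ℝ} (h0 : 0 < s) (h1 : s < 1) :
    AffineMap.lineMap p q s ∈ openSegment ℝ p q := by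
  rw [openSegment_eq_image_lineMap]
  exact ⟨s, ⟨h0, h1⟩, rfl⟩

section Chord

variable {K : Set (ℝ × ℝ)}

theorem openSegment_subset_of_mem_closure (hK : Convex ℝ K) (hKo : IsOpen K) {u v : ℝ × ℝ}
    (hu : u ∈ K) (hv : v ∈ closure K) : openSegment ℝ u v ⊆ K := by
  have := hK.openSegment_interior_closure_subset_interior
    (hKo.interior_eq.symm ▸ hu : u ∈ interior K) hv
  rwa [hKo.interior_eq] at this

/-- Two boundary points of a convex open set whose line meets the set bound a chord. -/
theorem chord_of_line_meets (hK : Convex ℝ K) (hKo : IsOpen K) {p q k : ℝ × ℝ}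
    (hp : p ∈ closure K \ K) (hq : q ∈ closure K \ K) (hpq : p ≠ q) (hk : k ∈ K)
    (h : orient p q k = 0) : k ∈ openSegment ℝ p q ∧ openSegment ℝ p q ⊆ K := by
  obtain ⟨s, rfl⟩ := exists_lineMap_of_orient_eq_zero hpq h
  have hs0 : 0 < s := by
    by_contra! hs
    apply hp.2
    rcases hs.eq_or_lt with rfl | hs
    · simpa using hk
    · refine openSegment_subset_of_mem_closure hK hKo hk hq.1 ?_
      rw [openSegment_eq_image_lineMap]
      have : 1 - s ≠ 0 := by linarith
      refine ⟨-s / (1 - s), ⟨div_pos (by linarith) (by linarith), ?_⟩, ?_⟩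
      · rw [div_lt_one (by linarith)]; linarith
      · ext <;> simp [AffineMap.lineMap_apply_module] <;> field_simp <;> ring
  have hs1 : s < 1 := by
    by_contra! hs
    apply hq.2
    rcases hs.eq_or_lt with rfl | hs
    · simpa using hk
    · refine openSegment_subset_of_mem_closure hK hKo hk hp.1 ?_
      rw [openSegment_eq_image_lineMap]
      have : s ≠ 0 := by linarith
      refine ⟨(s - 1) / s, ⟨div_pos (by linarith) (by linarith), ?_⟩, ?_⟩
      · rw [div_lt_one (by linarith)]; linarith
      · ext <;> simp [AffineMap.lineMap_apply_module] <;> field_simp <;> ring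
  refine ⟨lineMap_mem_openSegment hs0 hs1, ?_⟩
  intro w hw
  rw [openSegment_eq_image_lineMap] at hw
  obtain ⟨r, ⟨hr0, hr1⟩, rfl⟩ := hw
  rcases lt_trichotomy r s with hrs | rfl | hrs
  · refine openSegment_subset_of_mem_closure hK hKo hk hp.1 ?_
    rw [openSegment_eq_image_lineMap]
    refine ⟨(s - r) / s, ⟨div_pos (by linarith) (by linarith), ?_⟩, ?_⟩
    · rw [div_lt_one (by linarith)]; linarith
    · ext <;> simp [AffineMap.lineMap_apply_module] <;> field_simp <;> ring
  · exact hk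
  · refine openSegment_subset_of_mem_closure hK hKo hk hq.1 ?_
    rw [openSegment_eq_image_lineMap]
    have : 1 - s ≠ 0 := by linarith
    refine ⟨(r - s) / (1 - s), ⟨div_pos (by linarith) (by linarith), ?_⟩, ?_⟩
    · rw [div_lt_one (by linarith)]; linarith
    · ext <;> simp [AffineMap.lineMap_apply_module] <;> field_simp <;> ring

/-- A line that meets a convex open set has at most two points on the boundary. -/
theorem eq_or_eq_of_line_meets (hK : Convex ℝ K) (hKo : IsOpen K) {p q k w : ℝ × ℝ}
    (hp : p ∈ closure K \ K) (hq : q ∈ closure K \ K) (hpq : p ≠ q) (hk : k ∈ K)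
    (h : orient p q k = 0) (hw : w ∈ closure K \ K) (hw0 : orient p q w = 0) : w = p ∨ w = q := by
  by_contra! hne
  obtain ⟨s, rfl⟩ := exists_lineMap_of_orient_eq_zero hpq h
  obtain ⟨r, rfl⟩ := exists_lineMap_of_orient_eq_zero hpq hw0
  -- `k` would have to lie between any two of the three boundary points
  have key : ∀ u v : ℝ, u < v → AffineMap.lineMap p q u ∈ closure K \ K →
      AffineMap.lineMap p q v ∈ closure K \ K → u < s ∧ s < v := by
    intro u v huv hu hv
    have hinj : Function.Injective (AffineMap.lineMap p q : ℝ → ℝ × ℝ) :=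
      AffineMap.lineMap_injective ℝ hpq
    have h0 : orient (AffineMap.lineMap p q u) (AffineMap.lineMap p q v)
        (AffineMap.lineMap p q s) = 0 := by
      simp only [orient, AffineMap.lineMap_apply_module]
      simp
      ring
    have := (chord_of_line_meets hK hKo hu hv (hinj.ne huv.ne) hk h0).1
    rw [openSegment_eq_image_lineMap] at this
    obtain ⟨θ, ⟨h1, h2⟩, h3⟩ := this
    have h4 : (AffineMap.lineMap u v θ : ℝ) = s := by
      apply hinj
      rw [← h3]
      ext <;> simp [AffineMap.lineMap_apply_module] <;> ring
    simp [AffineMap.lineMap_apply_module'] at h4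
    constructor <;> nlinarith
  have h01 := key 0 1 one_pos (by simpa using hp) (by simpa using hq)
  rcases lt_trichotomy r 0 with hr | rfl | hr
  · have := key r 0 hr hw (by simpa using hp); linarith
  · simp at hne
  · rcases lt_trichotomy r 1 with hr1 | rfl | hr1
    · have := key 0 r hr (by simpa using hp) hw
      have := key r 1 hr1 hw (by simpa using hq); linarith
    · simp at hne
    · have := key 1 r hr1 (by simpa using hq) hw; linarith

theorem exists_orient_eq_zero (hK : Convex ℝ K) {p q u v : ℝ × ℝ} (hu : u ∈ K) (hv : v ∈ K)
    (hu0 : orient p q u ≤ 0) (hv0 : 0 ≤ orient p q v) : ∃ k ∈ K, orient p q k = 0 :=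
  hK.isPreconnected.intermediate_value hu hv (continuous_orient p q).continuousOn ⟨hu0, hv0⟩

theorem orient_neg_of_mem_openSegment {p q u v w : ℝ × ℝ} (hu : orient p q u < 0)
    (hv : orient p q v < 0) (hw : w ∈ openSegment ℝ u v) : orient p q w < 0 := by
  rw [openSegment_eq_image_lineMap] at hw
  obtain ⟨s, ⟨h0, h1⟩, rfl⟩ := hw
  rw [orient_lineMap]
  nlinarith

theorem orient_nonpos_of_mem_openSegment {p q u v w : ℝ × ℝ} (hu : orient p q u ≤ 0)
    (hv : orient p q v ≤ 0) (hw : w ∈ openSegment ℝ u v) : orient p q w ≤ 0 := by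
  rw [openSegment_eq_image_lineMap] at hw
  obtain ⟨s, ⟨h0, h1⟩, rfl⟩ := hw
  rw [orient_lineMap]
  nlinarith

/-- Let `I`, `J` be disjoint sets in the boundary of a convex open set `K`, on the right of the
chord from `z₀` (an endpoint of `I`) to `z₁` (an endpoint of `J`). Then the part of `K` to the left
of this chord is to the left of every chord from a point of `I` to a point of `J`. The
connectedness of `I` excludes that `z₁` is to the right of the chord from `x` to `y`: otherwise
the chord from `z₁` to `y` would separate `z₀` from `x`. -/
theorem cap_subset_left_of_chord (hK : Convex ℝ K) (hKo : IsOpen K) {I J : Set (ℝ × ℝ)}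
    {z₀ z₁ x y z : ℝ × ℝ} (hI : I ⊆ closure K \ K) (hJ : J ⊆ closure K \ K) (hIJ : Disjoint I J)
    (hz₀ : z₀ ∈ closure K \ K) (hz₁ : z₁ ∈ closure K \ K) (hne : z₀ ≠ z₁)
    (hcon : IsPreconnected (insert z₀ I)) (h0I : z₀ ∉ I) (h0J : z₀ ∉ J) (h1I : z₁ ∉ I)
    (h1J : z₁ ∉ J) (hgap : ∀ w ∈ I ∪ J, orient z₀ z₁ w ≤ 0) (hx : x ∈ I) (hy : y ∈ J)
    (hxy : openSegment ℝ x y ⊆ K) (hz : z ∈ K) (hz0 : 0 ≤ orient z₀ z₁ z) : 0 ≤ orient x y z := by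
  have hxyne : x ≠ y := fun h => hIJ.le_bot ⟨hx, h ▸ hy⟩
  have hm : AffineMap.lineMap x y (1 / 2 : ℝ) ∈ openSegment ℝ x y :=
    lineMap_mem_openSegment (by norm_num) (by norm_num)
  have hmxy : orient x y (AffineMap.lineMap x y (1 / 2 : ℝ)) = 0 := by simp [orient_lineMap]
  obtain ⟨k, hk, hk0⟩ := exists_orient_eq_zero hK (hxy hm) hz
    (orient_nonpos_of_mem_openSegment (hgap x (.inl hx)) (hgap y (.inr hy)) hm) hz0
  have hstrict : ∀ w ∈ I ∪ J, orient z₀ z₁ w < 0 := by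
    intro w hw
    refine lt_of_le_of_ne (hgap w hw) fun h => ?_
    have hwK : w ∈ closure K \ K := hw.elim (fun h => hI h) (fun h => hJ h)
    rcases eq_or_eq_of_line_meets hK hKo hz₀ hz₁ hne hk hk0 hwK h with rfl | rfl
    · exact hw.elim h0I h0J
    · exact hw.elim h1I h1J
  have hz1 : 0 < orient x y z₁ := by
    by_contra! hle
    have hlt : orient x y z₁ < 0 := by
      refine lt_of_le_of_ne hle fun h => ?_
      rcases eq_or_eq_of_line_meets hK hKo (hI hx) (hJ hy) hxyne (hxy hm) hmxy hz₁ h with rfl | rfl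
      · exact h1I hx
      · exact h1J hy
    have hz1y : z₁ ≠ y := fun h => h1J (h ▸ hy)
    have e0 : orient z₁ y z₀ < 0 := by rw [orient_cycle]; exact hstrict y (.inr hy)
    have e1 : 0 < orient z₁ y x := by
      rw [orient_swap, orient_cycle]; linarith
    obtain ⟨w, hw, hw0⟩ := hcon.intermediate_value (mem_insert _ _) (mem_insert_of_mem _ hx)
      (continuous_orient z₁ y).continuousOn ⟨e0.le, e1.le⟩
    have hwI : w ∈ I := by
      rcases hw with rfl | hw
      · exact absurd hw0 e0.ne
      · exact hw
    obtain ⟨k₁, h1, hk₁⟩ := mem_closure_iff.mp hz₀.1 _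
      (isOpen_Iio.preimage (continuous_orient z₁ y)) e0
    obtain ⟨k₂, h2, hk₂⟩ := mem_closure_iff.mp (hI hx).1 _
      (isOpen_Ioi.preimage (continuous_orient z₁ y)) e1
    obtain ⟨k', hk', hk'0⟩ := exists_orient_eq_zero hK hk₁ hk₂ (le_of_lt h1) (le_of_lt h2)
    rcases eq_or_eq_of_line_meets hK hKo hz₁ (hJ hy) hz1y hk' hk'0 (hI hwI) hw0 with rfl | rfl
    · exact h1I hwI
    · exact hIJ.le_bot ⟨hwI, hy⟩
  by_contra! hneg
  -- the point where the segment from `z` to `z₁` crosses the line through `x` and `y`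
  set A := orient x y z
  set B := orient x y z₁
  have hAB : 0 < B - A := by linarith
  have hr0 : 0 < -A / (B - A) := div_pos (by linarith) hAB
  have hr1 : -A / (B - A) < 1 := by rw [div_lt_one hAB]; linarith
  have hq : orient x y (AffineMap.lineMap z z₁ (-A / (B - A))) = 0 := by
    rw [orient_lineMap]
    change (1 - -A / (B - A)) * A + -A / (B - A) * B = 0
    field_simp
    ring
  have hqK := openSegment_subset_of_mem_closure hK hKo hz hz₁.1 (lineMap_mem_openSegment hr0 hr1)
  have hqs := (chord_of_line_meets hK hKo (hI hx) (hJ hy) hxyne hqK hq).1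
  have h1 := orient_neg_of_mem_openSegment (hstrict x (.inl hx)) (hstrict y (.inr hy)) hqs
  rw [orient_lineMap, orient_right] at h1
  nlinarith

end Chord

/-! ### The Klein model -/

/-- The Klein (projective) model of the hyperbolic plane, as the region above the parabola
`v = u²`: the map `x + i y ↦ (x, x² + y²)`, which sends geodesics to straight line segments. -/
def klein (z : ℍ) : ℝ × ℝ := (z.re, z.re ^ 2 + z.im ^ 2)

theorem isOpenEmbedding_klein : IsOpenEmbedding klein := by
  have hopen : IsOpen {v : ℝ × ℝ | v.1 ^ 2 < v.2} := isOpen_lt (by fun_prop) (by fun_prop)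
  let e : ℍ ≃ₜ {v : ℝ × ℝ | v.1 ^ 2 < v.2} :=
    { toFun := fun z => ⟨klein z, by
        have := z.im_pos
        simp only [klein, mem_ofPred_eq]
        nlinarith⟩
      invFun := fun v => ⟨⟨v.1.1, √(v.1.2 - v.1.1 ^ 2)⟩, Real.sqrt_pos.mpr (sub_pos.mpr v.2)⟩
      left_inv := fun z => by
        refine UpperHalfPlane.ext_re_im ?_ ?_
        · simp [klein]
        · simp [klein, Real.sqrt_sq z.im_pos.le]
      right_inv := fun v => by
        refine Subtype.ext (Prod.ext ?_ ?_)
        · simp [klein]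
        · have : 0 ≤ v.1.2 - v.1.1 ^ 2 := (sub_pos.mpr v.2).le
          simp [klein, Real.sq_sqrt this]
      continuous_toFun := by
        refine Continuous.subtype_mk ?_ _
        unfold klein
        have := UpperHalfPlane.continuous_re
        have := UpperHalfPlane.continuous_im
        fun_prop
      continuous_invFun := by
        rw [UpperHalfPlane.isEmbedding_coe.continuous_iff]
        simp only [Function.comp_def]
        have : (fun v : {v : ℝ × ℝ | v.1 ^ 2 < v.2} =>
            ((⟨v.1.1, √(v.1.2 - v.1.1 ^ 2)⟩ : ℂ))) =
            fun v => (v.1.1 : ℂ) + (√(v.1.2 - v.1.1 ^ 2) : ℝ) * Complex.I := by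
          ext v
          simp [Complex.ext_iff]
        rw [this]
        fun_prop }
  exact hopen.isOpenEmbedding_subtypeVal.comp e.isOpenEmbedding

theorem continuous_klein : Continuous klein := isOpenEmbedding_klein.continuous

theorem klein_injective : Function.Injective klein := isOpenEmbedding_klein.injective

/-- In homogeneous coordinates a geodesic is an affine function of `e^{2t}`. -/
theorem klein_geodesic (A : SL(2, ℝ)) (t : ℝ) :
    0 < A 1 0 ^ 2 * Real.exp t ^ 2 + A 1 1 ^ 2 ∧ klein (p (toG A * a t)) =
      ((A 0 0 * A 1 0 * Real.exp t ^ 2 + A 0 1 * A 1 1) /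
          (A 1 0 ^ 2 * Real.exp t ^ 2 + A 1 1 ^ 2),
        (A 0 0 ^ 2 * Real.exp t ^ 2 + A 0 1 ^ 2) /
          (A 1 0 ^ 2 * Real.exp t ^ 2 + A 1 1 ^ 2)) := by
  have h := normSq_denom_pos A (p (a t))
  have hdet := A.det_coe
  rw [Matrix.det_fin_two] at hdet
  rw [p_mul, toG_smul, klein, re_smul_SL, im_smul_SL]
  rw [re_p_a, im_p_a] at *
  have h' : 0 < A 1 0 ^ 2 * Real.exp t ^ 2 + A 1 1 ^ 2 := by nlinarith
  refine ⟨h', Prod.ext ?_ ?_⟩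
  · simp only
    congr 1 <;> ring
  · have e : (A 1 0 * 0 + A 1 1) ^ 2 + (A 1 0 * Real.exp t) ^ 2 =
      A 1 0 ^ 2 * Real.exp t ^ 2 + A 1 1 ^ 2 := by ring
    simp only [e]
    field_simp
    have e2 : (A 0 0 * A 1 1 - A 0 1 * A 1 0) ^ 2 = 1 := by rw [hdet]; ring
    linear_combination (-Real.exp t ^ 2) * e2

/-- The part of a geodesic strictly between two parameters is an open segment in the Klein model. -/
theorem klein_image_geodesic (g : G) {s t : ℝ} (hst : s < t) :
    (fun r => klein (p (g * a r))) '' Ioo s t =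
      openSegment ℝ (klein (p (g * a s))) (klein (p (g * a t))) := by
  obtain ⟨A, rfl⟩ := toG_surjective g
  obtain ⟨hDs, hs⟩ := klein_geodesic A s
  obtain ⟨hDt, ht⟩ := klein_geodesic A t
  have hσ : Real.exp s ^ 2 < Real.exp t ^ 2 := by
    have := Real.exp_lt_exp.mpr hst
    have := Real.exp_pos s
    nlinarith
  rw [hs, ht, openSegment_eq_image_lineMap]
  set Ds := A 1 0 ^ 2 * Real.exp s ^ 2 + A 1 1 ^ 2 with hDs'
  set Dt := A 1 0 ^ 2 * Real.exp t ^ 2 + A 1 1 ^ 2 with hDt'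
  apply Subset.antisymm
  · rintro _ ⟨r, ⟨h1, h2⟩, rfl⟩
    obtain ⟨hDr, hr⟩ := klein_geodesic A r
    simp only
    rw [hr]
    have hσ1 : Real.exp s ^ 2 < Real.exp r ^ 2 := by
      have := Real.exp_lt_exp.mpr h1
      have := Real.exp_pos s
      nlinarith
    have hσ2 : Real.exp r ^ 2 < Real.exp t ^ 2 := by
      have := Real.exp_lt_exp.mpr h2
      have := Real.exp_pos r
      nlinarith
    set Dr := A 1 0 ^ 2 * Real.exp r ^ 2 + A 1 1 ^ 2 with hDr'
    set σ := Real.exp s ^ 2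
    set τ := Real.exp t ^ 2
    set ρ := Real.exp r ^ 2
    have hτσ : τ - σ ≠ 0 := by linarith
    refine ⟨((ρ - σ) * Dt) / ((τ - σ) * Dr), ⟨?_, ?_⟩, ?_⟩
    · have : 0 < ρ - σ := by linarith
      have : 0 < τ - σ := by linarith
      positivity
    · have h : 0 < τ - σ := by linarith
      rw [div_lt_one (by positivity)]
      have : (τ - σ) * Dr - (ρ - σ) * Dt = (τ - ρ) * Ds := by
        rw [hDr', hDt', hDs']; ring
      have : 0 < (τ - ρ) * Ds := mul_pos (by linarith) hDs
      linarith
    · have e : (1 : ℝ) - ((ρ - σ) * Dt) / ((τ - σ) * Dr) = ((τ - ρ) * Ds) / ((τ - σ) * Dr) := by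
        have : (τ - σ) * Dr - (ρ - σ) * Dt = (τ - ρ) * Ds := by
          rw [hDr', hDt', hDs']; ring
        rw [← this]
        field_simp
      rw [AffineMap.lineMap_apply_module, e]
      ext
      · simp
        field_simp
        ring
      · simp
        field_simp
        ring
  · rintro _ ⟨θ, ⟨h1, h2⟩, rfl⟩
    set σ := Real.exp s ^ 2 with hσ'
    set τ := Real.exp t ^ 2 with hτ'
    have hw : 0 < (1 - θ) * Dt + θ * Ds := by
      have : 0 < 1 - θ := by linarith
      positivity
    set ρ := ((1 - θ) * Dt * σ + θ * Ds * τ) / ((1 - θ) * Dt + θ * Ds) with hρ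
    have hσ0 : 0 < σ := by positivity
    have hρ1 : σ < ρ := by
      rw [hρ, lt_div_iff₀ hw]
      have : 0 < θ * Ds * (τ - σ) := mul_pos (by positivity) (by linarith)
      linarith
    have hρ2 : ρ < τ := by
      rw [hρ, div_lt_iff₀ hw]
      have : 0 < (1 - θ) * Dt * (τ - σ) :=
        mul_pos (mul_pos (by linarith) hDt) (by linarith)
      linarith
    have hexp : Real.exp (Real.log ρ / 2) ^ 2 = ρ := by
      rw [← Real.exp_nat_mul]
      push_cast
      rw [mul_div_cancel₀ _ (by norm_num : (2:ℝ) ≠ 0), Real.exp_log (by linarith)]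
    refine ⟨Real.log ρ / 2, ⟨?_, ?_⟩, ?_⟩
    · have : Real.log σ < Real.log ρ := Real.log_lt_log hσ0 hρ1
      rw [hσ', Real.log_pow, Real.log_exp] at this
      push_cast at this
      linarith
    · have : Real.log ρ < Real.log τ := Real.log_lt_log (by linarith) hρ2
      rw [hτ', Real.log_pow, Real.log_exp] at this
      push_cast at this
      linarith
    · obtain ⟨hDr, hr⟩ := klein_geodesic A (Real.log ρ / 2)
      simp only
      rw [hr, AffineMap.lineMap_apply_module]
      rw [hexp] at hDr ⊢
      have e : A 1 0 ^ 2 * ρ + A 1 1 ^ 2 = Ds * Dt / ((1 - θ) * Dt + θ * Ds) := by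
        rw [hρ]
        field_simp
        rw [hDs', hDt']
        ring
      rw [e, hρ]
      ext
      · simp
        field_simp
        ring
      · simp
        field_simp
        ring

/-- The Klein model preserves the orientation. -/
theorem orient_klein_geodesic (g : G) {s t : ℝ} (hst : s < t) :
    ∃ c : ℝ → ℝ → ℝ, ∀ z : ℍ, 0 < c z.re z.im ∧
      orient (klein (p (g * a s))) (klein (p (g * a t))) (klein z) =
        -(c z.re z.im * (g⁻¹ • z).re) := by
  obtain ⟨A, rfl⟩ := toG_surjective g
  obtain ⟨hDs, hs⟩ := klein_geodesic A s
  obtain ⟨hDt, ht⟩ := klein_geodesic A t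
  have hσ : Real.exp s ^ 2 < Real.exp t ^ 2 := by
    have := Real.exp_lt_exp.mpr hst
    have := Real.exp_pos s
    nlinarith
  have hdet := A.det_coe
  rw [Matrix.det_fin_two] at hdet
  obtain ⟨i00, i01, i10, i11⟩ := SL_inv_entries A
  refine ⟨fun x y => (Real.exp t ^ 2 - Real.exp s ^ 2) *
    ((-A 1 0 * x + A 0 0) ^ 2 + (-A 1 0 * y) ^ 2) /
      ((A 1 0 ^ 2 * Real.exp s ^ 2 + A 1 1 ^ 2) * (A 1 0 ^ 2 * Real.exp t ^ 2 + A 1 1 ^ 2)),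
      fun z => ?_⟩
  have hN := normSq_denom_pos A⁻¹ z
  rw [i10, i11] at hN
  refine ⟨?_, ?_⟩
  · refine div_pos (mul_pos (by linarith) hN) (mul_pos hDs hDt)
  · rw [← toG_inv, toG_smul, re_smul_SL, i00, i01, i10, i11, hs, ht]
    simp only [orient, klein]
    set σ := Real.exp s ^ 2
    set τ := Real.exp t ^ 2
    set Ds := A 1 0 ^ 2 * σ + A 1 1 ^ 2 with hDs'
    set Dt := A 1 0 ^ 2 * τ + A 1 1 ^ 2 with hDt'
    have hcancel : ∀ M N : ℝ, 0 < N →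
        (τ - σ) * N / (Ds * Dt) * (M / N) = (τ - σ) * M / (Ds * Dt) := by
      intro M N hN
      field_simp
    rw [hcancel _ _ hN]
    field_simp
    rw [hDs', hDt']
    linear_combination (-(A 1 0 ^ 2 * σ + A 1 1 ^ 2) * (τ - σ)) * (-(A 0 0 * A 0 1) +
      (A 0 0 * A 1 1 + A 0 1 * A 1 0) * z.re - A 1 0 * A 1 1 * (z.re ^ 2 + z.im ^ 2)) * hdet

/-! ### Geodesics and rotations -/

theorem rot_entries (θ : ℝ) : rot θ 0 0 = Real.cos θ ∧ rot θ 0 1 = Real.sin θ ∧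
    rot θ 1 0 = -Real.sin θ ∧ rot θ 1 1 = Real.cos θ := by
  simp [rot]

theorem rot_smul_I (θ : ℝ) : rot θ • UpperHalfPlane.I = UpperHalfPlane.I := by
  obtain ⟨h1, h2, h3, h4⟩ := rot_entries θ
  refine UpperHalfPlane.ext_re_im ?_ ?_
  · rw [re_smul_SL, h1, h2, h3, h4]
    simp
    ring
  · rw [im_smul_SL, h3, h4]
    simp

theorem exists_rot_smul_re_eq_zero (w : ℍ) : ∃ θ : ℝ, (rot θ • w).re = 0 := by
  let f : ℝ → ℝ := fun θ => (Real.cos θ * -Real.sin θ) * (w.re ^ 2 + w.im ^ 2) +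
      (Real.cos θ * Real.cos θ + Real.sin θ * -Real.sin θ) * w.re + Real.sin θ * Real.cos θ
  have hf : Continuous f := by fun_prop
  have h0 : f 0 = w.re := by simp [f]
  have h1 : f (Real.pi / 2) = -w.re := by simp [f]
  have : (0 : ℝ) ∈ range f := by
    rcases le_total w.re 0 with h | h
    · exact mem_range_of_exists_le_of_exists_ge hf ⟨0, by linarith⟩ ⟨Real.pi / 2, by linarith⟩
    · exact mem_range_of_exists_le_of_exists_ge hf ⟨Real.pi / 2, by linarith⟩ ⟨0, by linarith⟩
  obtain ⟨θ, hθ⟩ := this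
  refine ⟨θ, ?_⟩
  obtain ⟨h1, h2, h3, h4⟩ := rot_entries θ
  rw [re_smul_SL, h1, h2, h3, h4, div_eq_zero_iff]
  exact Or.inl hθ

theorem eq_p_a_of_re_eq_zero {w : ℍ} (h : w.re = 0) : w = p (a (Real.log w.im)) :=
  UpperHalfPlane.ext_re_im (by rw [re_p_a, h]) (by rw [im_p_a, Real.exp_log w.im_pos])

theorem exists_geodesic {z w : ℍ} (hne : z ≠ w) :
    ∃ (g : G) (t : ℝ), 0 < t ∧ p g = z ∧ p (g * a t) = w := by
  obtain ⟨θ, hθ⟩ := exists_rot_smul_re_eq_zero (z.toSL2R⁻¹ • w)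
  set v := rot θ • z.toSL2R⁻¹ • w with hv
  have hw : w = (z.toSL2R * (rot θ)⁻¹) • v := by
    rw [hv, mul_smul, inv_smul_smul, smul_inv_smul]
  have hz : (z.toSL2R * (rot θ)⁻¹) • UpperHalfPlane.I = z := by
    rw [mul_smul, inv_smul_eq_iff.mpr (rot_smul_I θ).symm, UpperHalfPlane.toSL2R_smul_I]
  set B := z.toSL2R * (rot θ)⁻¹
  have hva := eq_p_a_of_re_eq_zero hθ
  rcases lt_trichotomy (Real.log v.im) 0 with hs | hs | hs
  · -- the half-turn about `i` reverses the direction of the geodesic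
    have hR : ∀ s, rot (Real.pi / 2) • p (a (-s)) = p (a s) := by
      intro s
      obtain ⟨h1, h2, h3, h4⟩ := rot_entries (Real.pi / 2)
      rw [Real.sin_pi_div_two] at h2 h3
      rw [Real.cos_pi_div_two] at h1 h4
      refine UpperHalfPlane.ext_re_im ?_ ?_
      · rw [re_smul_SL, h1, h2, h3, h4, re_p_a, re_p_a]; simp
      · rw [im_smul_SL, h3, h4, re_p_a, im_p_a, im_p_a, Real.exp_neg]
        field_simp
        ring
    refine ⟨toG (B * rot (Real.pi / 2)), -Real.log v.im, by linarith, ?_, ?_⟩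
    · rw [p, toG_smul, mul_smul, rot_smul_I, hz]
    · rw [p_mul, toG_smul, mul_smul, hR, ← hva, ← hw]
  · rw [hs, a_zero, p, one_smul] at hva
    rw [hva, hz] at hw
    exact absurd hw.symm hne
  · refine ⟨toG B, Real.log v.im, hs, hz, ?_⟩
    rw [p_mul, toG_smul, ← hva, ← hw]

theorem p_a_add (g : G) (s t : ℝ) : p (g * a s * a t) = p (g * a (s + t)) := by
  rw [mul_assoc, a_add]

theorem continuous_p_geodesic (g : G) : Continuous fun t => p (g * a t) :=
  continuous_p.comp (continuous_const.mul continuous_a)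

/-- The left half-plane of a geodesic in the Klein model. -/
theorem mem_leftSide_iff (g : G) {s t : ℝ} (hst : s < t) (z : ℍ) :
    z ∈ leftSide g ↔ 0 ≤ orient (klein (p (g * a s))) (klein (p (g * a t))) (klein z) := by
  obtain ⟨c, hc⟩ := orient_klein_geodesic g hst
  obtain ⟨h1, h2⟩ := hc z
  rw [h2, leftSide, mem_ofPred_eq]
  constructor <;> intro h <;> nlinarith

theorem re_neg_iff (g : G) {s t : ℝ} (hst : s < t) (z : ℍ) :
    (g⁻¹ • z).re < 0 ↔ 0 < orient (klein (p (g * a s))) (klein (p (g * a t))) (klein z) := by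
  obtain ⟨c, hc⟩ := orient_klein_geodesic g hst
  obtain ⟨h1, h2⟩ := hc z
  rw [h2]
  constructor <;> intro h <;> nlinarith

theorem leftSide_mul_a (g : G) (t : ℝ) : leftSide (g * a t) = leftSide g := by
  ext z
  simp only [leftSide, mem_ofPred_eq, mul_inv_rev, mul_smul, ← a_neg, re_a_smul]
  have := Real.exp_pos (-t)
  constructor <;> intro h <;> nlinarith

theorem isClosed_leftSide (g : G) : IsClosed (leftSide g) :=
  isClosed_le (UpperHalfPlane.continuous_re.comp (continuous_const_smul _)) continuous_const

theorem smul_leftSide (g h : G) : g • leftSide h = leftSide (g * h) := by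
  ext z
  simp only [leftSide, mem_smul_set_iff_inv_smul_mem, mem_ofPred_eq, mul_inv_rev, mul_smul]

theorem volume_re_eq_zero : (volume : Measure ℍ) {z | z.re = 0} = 0 := by
  rw [UpperHalfPlane.volume_eq_lintegral]
  apply setLIntegral_measure_zero
  refine measure_mono_null (t := ((LinearMap.ker Complex.reLm : Submodule ℝ ℂ) : Set ℂ)) ?_ ?_
  · rintro _ ⟨z, hz, rfl⟩
    simpa using hz
  · refine Measure.addHaar_submodule volume _ ?_
    intro h
    have : (1 : ℂ) ∈ LinearMap.ker Complex.reLm := by rw [h]; trivial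
    simp at this

theorem volume_geodesicSegment {s : Set ℍ} (hs : IsGeodesicSegment s) :
    (volume : Measure ℍ) s = 0 := by
  obtain ⟨g, T, -, rfl⟩ := hs
  refine measure_mono_null ?_ ((smulInvariant_G g⁻¹).measure_preimage
    (measurableSet_eq_fun (UpperHalfPlane.continuous_re.measurable)
      measurable_const).nullMeasurableSet |>.trans volume_re_eq_zero)
  rintro _ ⟨t, -, rfl⟩
  simp [← p_mul, re_p_a]

/-! ### Geometry of a fundamental polygon -/

section Polygon

variable {Γ : Subgroup G} {F : Set ℍ}

theorem IsFundamentalPolygon.volume_frontier (hF : IsFundamentalPolygon Γ F) :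
    (volume : Measure ℍ) (frontier F) = 0 := by
  obtain ⟨S, hS, hseg, hU⟩ := hF.finite_boundary
  rw [hU, measure_sUnion_null_iff hS.countable]
  exact fun s hs => volume_geodesicSegment (hseg s hs)

theorem IsFundamentalPolygon.convex_klein (hF : IsFundamentalPolygon Γ F) :
    Convex ℝ (klein '' F) := by
  rw [convex_iff_openSegment_subset]
  rintro _ ⟨z, hz, rfl⟩ _ ⟨w, hw, rfl⟩
  by_cases hne : z = w
  · subst hne
    simpa using ⟨z, hz, rfl⟩
  obtain ⟨g, t, ht, rfl, rfl⟩ := exists_geodesic hne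
  have h := klein_image_geodesic g ht
  rw [a_zero, mul_one] at h
  rw [← h]
  rintro _ ⟨r, hr, rfl⟩
  refine mem_image_of_mem _ ((hF.convex g).out (?_ : (0 : ℝ) ∈ _) hw ⟨hr.1.le, hr.2.le⟩)
  simpa [a_zero] using hz

theorem IsFundamentalPolygon.isOpen_klein (hF : IsFundamentalPolygon Γ F) :
    IsOpen (klein '' F) :=
  isOpenEmbedding_klein.isOpenMap _ hF.isOpen

theorem mem_closure_klein_iff {z : ℍ} : klein z ∈ closure (klein '' F) ↔ z ∈ closure F := by
  rw [isOpenEmbedding_klein.isInducing.closure_eq_preimage_closure_image F, mem_preimage]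

theorem IsFundamentalPolygon.mem_frontier_klein_iff (hF : IsFundamentalPolygon Γ F) {z : ℍ} :
    klein z ∈ closure (klein '' F) \ klein '' F ↔ z ∈ frontier F := by
  rw [hF.isOpen.frontier_eq, Set.mem_sdiff, Set.mem_sdiff, mem_closure_klein_iff,
    klein_injective.mem_set_image]

theorem IsFundamentalPolygon.not_mem_of_mem_frontier (hF : IsFundamentalPolygon Γ F) {z : ℍ}
    (hz : z ∈ frontier F) : z ∉ F := by
  rw [hF.isOpen.frontier_eq] at hz
  exact hz.2

theorem IsFundamentalPolygon.mem_of_between (hF : IsFundamentalPolygon Γ F) {g : G} {s t : ℝ}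
    (hs : p (g * a s) ∈ closure F) (ht : p (g * a t) ∈ F) {r : ℝ}
    (hr : s < r ∧ r < t ∨ t < r ∧ r < s) : p (g * a r) ∈ F := by
  have key : openSegment ℝ (klein (p (g * a t))) (klein (p (g * a s))) ⊆ klein '' F :=
    openSegment_subset_of_mem_closure hF.convex_klein hF.isOpen_klein
      (mem_image_of_mem _ ht) (mem_closure_klein_iff.mpr hs)
  rw [← klein_injective.mem_set_image]
  apply key
  rcases hr with hr | hr
  · rw [openSegment_symm, ← klein_image_geodesic g (hr.1.trans hr.2)]
    exact ⟨r, hr, rfl⟩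
  · rw [← klein_image_geodesic g (hr.1.trans hr.2)]
    exact ⟨r, hr, rfl⟩

theorem IsFundamentalPolygon.mem_closure_of_between (hF : IsFundamentalPolygon Γ F) {g : G}
    {s t : ℝ} (hs : p (g * a s) ∈ closure F) (ht : p (g * a t) ∈ closure F) {r : ℝ}
    (hr : s < r ∧ r < t) : p (g * a r) ∈ closure F := by
  rw [← mem_closure_klein_iff]
  apply hF.convex_klein.closure.openSegment_subset (mem_closure_klein_iff.mpr hs)
    (mem_closure_klein_iff.mpr ht)
  rw [← klein_image_geodesic g (hr.1.trans hr.2)]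
  exact ⟨r, hr, rfl⟩

/-- The frames whose base point lies in the open polygon `F` and whose geodesic came from `I` and
goes to `J`. -/
def innerCrossing (F I J : Set ℍ) : Set G := crossing I J ∩ p ⁻¹' F

theorem crossing_subset (hF : IsFundamentalPolygon Γ F) {I J : Set ℍ} (hI : I ⊆ frontier F)
    (hJ : J ⊆ frontier F) : crossing I J ⊆ innerCrossing F I J ∪ p ⁻¹' frontier F := by
  rintro g ⟨l₁, h1, l₂, h2, hg1, hg2⟩
  by_cases hgF : p g ∈ F
  · exact Or.inl ⟨⟨l₁, h1, l₂, h2, hg1, hg2⟩, hgF⟩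
  · right
    rw [mem_preimage, hF.isOpen.frontier_eq]
    refine ⟨?_, hgF⟩
    have := hF.mem_closure_of_between (g := g) (r := 0) (frontier_subset_closure (hI hg1))
      (frontier_subset_closure (hJ hg2)) ⟨by linarith, h2⟩
    simpa [a_zero] using this

/-- The exit from the convex polygon is transversal, so a nearby geodesic exits at a nearby point of
the boundary. This is the openness in one direction of time, `ε = ± 1`. -/
theorem IsFundamentalPolygon.eventually_exits (hF : IsFundamentalPolygon Γ F) {J U : Set ℍ}
    (hU : IsOpen U) (hJ : J = U ∩ frontier F) {g : G} (hg : p g ∈ F) {ε l : ℝ} (hε : ε ≠ 0)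
    (hl : 0 < l) (hgl : p (g * a (ε * l)) ∈ J) :
    ∀ᶠ h in 𝓝 g, ∃ l' > 0, p (h * a (ε * l')) ∈ J := by
  have hcont : Continuous fun q : G × ℝ => p (q.1 * a (ε * q.2)) :=
    continuous_p.comp (continuous_fst.mul (continuous_a.comp (continuous_const.mul continuous_snd)))
  rw [hJ] at hgl
  have hUn : ∀ᶠ q in 𝓝 (g, l), p (q.1 * a (ε * q.2)) ∈ U :=
    hcont.continuousAt.eventually (hU.mem_nhds hgl.1)
  rw [nhds_prod_eq] at hUn
  obtain ⟨P, hP, Q, hQ, hPQ⟩ := eventually_prod_iff.mp hUn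
  obtain ⟨δ, hδ, hball⟩ := Metric.eventually_nhds_iff.mp hQ
  set η := min (δ / 2) (l / 2) with hη
  have hη0 : 0 < η := lt_min (by linarith) (by linarith)
  have hηδ : η < δ := (min_le_left _ _).trans_lt (by linarith)
  have hηl : η < l := (min_le_right _ _).trans_lt (by linarith)
  have hg0 : p (g * a 0) ∈ F := by simpa [a_zero] using hg
  have hin : p (g * a (ε * (l - η))) ∈ F := by
    refine hF.mem_of_between (frontier_subset_closure hgl.2) hg0 ?_
    rcases lt_or_gt_of_ne hε with h | h
    · left; constructor <;> nlinarith
    · right; constructor <;> nlinarith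
  have hout : p (g * a (ε * (l + η))) ∉ closure F := by
    intro hcl
    refine hF.not_mem_of_mem_frontier hgl.2 (hF.mem_of_between hcl hg0 ?_)
    rcases lt_or_gt_of_ne hε with h | h
    · left; constructor <;> nlinarith
    · right; constructor <;> nlinarith
  have hc1 : Continuous fun h : G => p (h * a (ε * (l - η))) :=
    continuous_p.comp (continuous_id.mul continuous_const)
  have hc2 : Continuous fun h : G => p (h * a (ε * (l + η))) :=
    continuous_p.comp (continuous_id.mul continuous_const)
  filter_upwards [hP, hc1.continuousAt.eventually (hF.isOpen.mem_nhds hin),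
    hc2.continuousAt.eventually (isClosed_closure.isOpen_compl.mem_nhds hout)] with h h1 h2 h3
  have hcg : Continuous fun t => p (h * a (ε * t)) :=
    (continuous_p_geodesic h).comp (continuous_const.mul continuous_id)
  -- the geodesic of `h` hits the boundary between the parameters `l - η` and `l + η`
  have hpre : IsPreconnected ((fun t => p (h * a (ε * t))) '' Icc (l - η) (l + η)) :=
    isPreconnected_Icc.image _ hcg.continuousOn
  obtain ⟨w, ⟨t, ht, rfl⟩, hw⟩ : (((fun t => p (h * a (ε * t))) '' Icc (l - η) (l + η)) ∩
      frontier F).Nonempty := by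
    by_contra hempty
    rw [not_nonempty_iff_eq_empty] at hempty
    have hsub : ((fun t => p (h * a (ε * t))) '' Icc (l - η) (l + η)) ⊆ F ∪ (closure F)ᶜ := by
      rintro w hw
      by_contra hwF
      simp only [mem_union, mem_compl_iff, not_or, not_not] at hwF
      have : w ∈ (∅ : Set ℍ) := hempty ▸ ⟨hw, hF.isOpen.frontier_eq ▸ ⟨hwF.2, hwF.1⟩⟩
      exact this
    obtain ⟨w, -, hw1, hw2⟩ := hpre F (closure F)ᶜ hF.isOpen isClosed_closure.isOpen_compl hsub
      ⟨_, ⟨l - η, ⟨le_rfl, by linarith⟩, rfl⟩, h2⟩ ⟨_, ⟨l + η, ⟨by linarith, le_rfl⟩, rfl⟩, h3⟩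
    exact hw2 (subset_closure hw1)
  refine ⟨t, by linarith [ht.1], ?_⟩
  rw [hJ]
  refine ⟨hPQ h1 (hball ?_), hw⟩
  rw [Real.dist_eq, abs_lt]
  constructor <;> linarith [ht.1, ht.2]

theorem isOpen_innerCrossing (hF : IsFundamentalPolygon Γ F) {I J : Set ℍ}
    (hI : IsBoundaryArc F I) (hJ : IsBoundaryArc F J) : IsOpen (innerCrossing F I J) := by
  obtain ⟨-, -, U, hU, hIU⟩ := hI
  obtain ⟨-, -, V, hV, hJV⟩ := hJ
  rw [isOpen_iff_mem_nhds]
  rintro g ⟨⟨l₁, h1, l₂, h2, hg1, hg2⟩, hgF⟩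
  have e1 := hF.eventually_exits hU hIU hgF (ε := -1) (by norm_num) h1 (by simpa using hg1)
  have e2 := hF.eventually_exits hV hJV hgF (ε := 1) (by norm_num) h2 (by simpa using hg2)
  filter_upwards [e1, e2, (hF.isOpen.preimage continuous_p).mem_nhds hgF] with h h1 h2 h3
  obtain ⟨m₁, hm1, hm1'⟩ := h1
  obtain ⟨m₂, hm2, hm2'⟩ := h2
  exact ⟨⟨m₁, hm1, m₂, hm2, by simpa using hm1', by simpa using hm2'⟩, h3⟩

/-- A geodesic through the convex polygon stays in it exactly between its entrance and its exit. -/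
theorem IsFundamentalPolygon.mem_iff_of_frontier (hF : IsFundamentalPolygon Γ F) {g : G} {s t r : ℝ}
    (hs : p (g * a s) ∈ frontier F) (ht : p (g * a t) ∈ frontier F) (hr : p (g * a r) ∈ F)
    (hsr : s < r) (hrt : r < t) (u : ℝ) : p (g * a u) ∈ F ↔ u ∈ Ioo s t := by
  constructor
  · intro hu
    constructor
    · by_contra! hle
      rcases hle.eq_or_lt with rfl | hlt
      · exact hF.not_mem_of_mem_frontier hs hu
      · exact hF.not_mem_of_mem_frontier hs
          ((hF.convex g).out hu hr ⟨hlt.le, hsr.le⟩)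
    · by_contra! hle
      rcases hle.eq_or_lt with rfl | hlt
      · exact hF.not_mem_of_mem_frontier ht hu
      · exact hF.not_mem_of_mem_frontier ht
          ((hF.convex g).out hr hu ⟨hrt.le, hlt.le⟩)
  · rintro ⟨h1, h2⟩
    rcases lt_trichotomy u r with h | rfl | h
    · exact hF.mem_of_between (frontier_subset_closure hs) hr (.inl ⟨h1, h⟩)
    · exact hr
    · exact hF.mem_of_between (frontier_subset_closure ht) hr (.inr ⟨h, h2⟩)

theorem exists_of_mem_innerCrossing (hF : IsFundamentalPolygon Γ F) {I J : Set ℍ}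
    (hI : I ⊆ frontier F) (hJ : J ⊆ frontier F) {g : G} {r : ℝ}
    (h : g * a r ∈ innerCrossing F I J) : ∃ s t, s < r ∧ r < t ∧ p (g * a s) ∈ I ∧
      p (g * a t) ∈ J ∧ (∀ u, p (g * a u) ∈ F ↔ u ∈ Ioo s t) ∧
      ENNReal.ofReal (t - s) ≤ maxCrossingLength I J := by
  obtain ⟨⟨l₁, h1, l₂, h2, hg1, hg2⟩, hgF⟩ := h
  have e : ENNReal.ofReal (l₁ + l₂) ≤ maxCrossingLength I J := by
    unfold maxCrossingLength
    exact le_iSup_of_le (g * a r) (le_iSup_of_le l₁ (le_iSup_of_le l₂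
      (le_iSup_of_le ⟨h1, h2, hg1, hg2⟩ le_rfl)))
  rw [p_a_add] at hg1 hg2
  refine ⟨r + -l₁, r + l₂, by linarith, by linarith, hg1, hg2, ?_, by convert e using 2; ring⟩
  exact hF.mem_iff_of_frontier (hI hg1) (hJ hg2) hgF (by linarith) (by linarith)

theorem volume_innerCrossing_le (hF : IsFundamentalPolygon Γ F) {I J : Set ℍ}
    (hI : I ⊆ frontier F) (hJ : J ⊆ frontier F) (g : G) :
    volume {r : ℝ | g * a r ∈ innerCrossing F I J} ≤ maxCrossingLength I J := by
  rcases eq_empty_or_nonempty {r : ℝ | g * a r ∈ innerCrossing F I J} with h | ⟨r, hr⟩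
  · simp [h]
  obtain ⟨s, t, -, -, -, -, hiff, hle⟩ := exists_of_mem_innerCrossing hF hI hJ hr
  refine le_trans (measure_mono (t := Ioo s t) fun u hu => (hiff u).mp hu.2) ?_
  rwa [Real.volume_Ioo]

/-- The cap cut off by a gap chord lies to the left of every geodesic that crosses the polygon
from `I` to `J`. -/
theorem leftSide_gapChord_subset (hF : IsFundamentalPolygon Γ F) {I J : Set ℍ}
    (hI : IsBoundaryArc F I) (hJ : IsBoundaryArc F J) (hIJ : Disjoint I J) {h g : G}
    (hh : IsGapChord F I J h) (hg : g ∈ innerCrossing F I J) :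
    leftSide h ∩ F ⊆ leftSide g := by
  obtain ⟨hz0, ⟨t, ht, hz1⟩, hdisj⟩ := hh
  obtain ⟨hIf, hIc, U, hU, hIU⟩ := hI
  obtain ⟨hJf, hJc, V, hV, hJV⟩ := hJ
  have hclf : closure (frontier F) = frontier F := isClosed_frontier.closure_eq
  have hz0f : p h ∈ frontier F := hclf ▸ closure_mono hIf hz0.1
  have hz1f : p (h * a t) ∈ frontier F := hclf ▸ closure_mono hJf hz1.1
  have h0J : p h ∉ J := by
    intro hJ'
    rw [hJV] at hJ'
    obtain ⟨w, hwV, hwI⟩ := mem_closure_iff.mp hz0.1 V hV hJ'.1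
    exact hIJ.le_bot ⟨hwI, hJV ▸ ⟨hwV, hIf hwI⟩⟩
  have h1I : p (h * a t) ∉ I := by
    intro hI'
    rw [hIU] at hI'
    obtain ⟨w, hwU, hwJ⟩ := mem_closure_iff.mp hz1.1 U hU hI'.1
    exact hIJ.le_bot ⟨hIU ▸ ⟨hwU, hJf hwJ⟩, hwJ⟩
  have hne : p h ≠ p (h * a t) := by
    intro he
    rw [p_mul] at he
    have he' : UpperHalfPlane.I = p (a t) := smul_left_cancel h he
    have := congrArg UpperHalfPlane.im he'
    rw [im_p_a, UpperHalfPlane.I_im] at this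
    exact absurd (Real.exp_eq_one_iff t |>.mp this.symm) ht.ne'
  have hcon : IsPreconnected (insert (p h) I) :=
    hIc.isPreconnected.subset_closure (subset_insert _ _)
      (insert_subset hz0.1 subset_closure)
  have hor : ∀ z, (h⁻¹ • z).re < 0 ↔ 0 < orient (klein (p h)) (klein (p (h * a t))) (klein z) := by
    intro z
    have := re_neg_iff h ht z
    rwa [a_zero, mul_one] at this
  have hgap : ∀ w ∈ klein '' I ∪ klein '' J,
      orient (klein (p h)) (klein (p (h * a t))) w ≤ 0 := by
    rw [← image_union]
    rintro _ ⟨w, hw, rfl⟩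
    by_contra! hlt
    exact hdisj.le_bot ⟨⟨hw.elim (fun h => hIf h) (fun h => hJf h), (hor w).mpr hlt⟩, hw⟩
  have hg0 : g * a 0 ∈ innerCrossing F I J := by rwa [a_zero, mul_one]
  obtain ⟨s, t', hs, ht', hgs, hgt, hiff, -⟩ := exists_of_mem_innerCrossing hF hIf hJf hg0
  rintro z ⟨hzl, hzF⟩
  rw [mem_leftSide_iff g (hs.trans ht')]
  have hzl' := (mem_leftSide_iff h ht z).mp hzl
  rw [a_zero, mul_one] at hzl'
  refine cap_subset_left_of_chord hF.convex_klein hF.isOpen_klein (I := klein '' I)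
    (J := klein '' J) (z₀ := klein (p h)) (z₁ := klein (p (h * a t))) ?_ ?_
    ((disjoint_image_iff klein_injective).mpr hIJ)
    (hF.mem_frontier_klein_iff.mpr hz0f) (hF.mem_frontier_klein_iff.mpr hz1f)
    (klein_injective.ne hne) ?_ ?_ ?_ ?_ ?_ hgap (mem_image_of_mem _ hgs) (mem_image_of_mem _ hgt)
    ?_ (mem_image_of_mem _ hzF) hzl'
  · rintro _ ⟨w, hw, rfl⟩
    exact hF.mem_frontier_klein_iff.mpr (hIf hw)
  · rintro _ ⟨w, hw, rfl⟩
    exact hF.mem_frontier_klein_iff.mpr (hJf hw)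
  · rw [← image_insert_eq]
    exact hcon.image _ continuous_klein.continuousOn
  · rw [klein_injective.mem_set_image]; exact hz0.2
  · rw [klein_injective.mem_set_image]; exact h0J
  · rw [klein_injective.mem_set_image]; exact h1I
  · rw [klein_injective.mem_set_image]; exact hz1.2
  · rw [← klein_image_geodesic g (hs.trans ht')]
    rintro _ ⟨u, hu, rfl⟩
    exact mem_image_of_mem _ ((hiff u).mpr hu)

end Polygon

/-! ### Counting the crossings of closed geodesics -/

section Counting

variable {Γ : Subgroup G} {F : Set ℍ}

theorem countable_of_discrete [DiscreteTopology Γ] : Countable Γ :=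
  TopologicalSpace.separableSpace_iff_countable.mp inferInstance

/-- The translates of a fundamental polygon by distinct elements of `Γ` are disjoint. -/
theorem IsFundamentalPolygon.eq_one_of_mem (hF : IsFundamentalPolygon Γ F) {γ : G} (hγ : γ ∈ Γ)
    {z : ℍ} (hz : z ∈ F) (hγz : γ • z ∈ F) : γ = 1 := by
  refine eq_one_of_fixes_open (U := F ∩ (fun z => γ • z) ⁻¹' F)
    (hF.isOpen.inter (hF.isOpen.preimage (continuous_const_smul γ))) ⟨z, hz, hγz⟩ ?_
  rintro w ⟨hw, hγw⟩
  rcases hF.boundary_of_equiv γ hγ w (subset_closure hw) (subset_closure hγw) with h | h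
  · exact h.symm
  · exact absurd hw (hF.not_mem_of_mem_frontier h.1)

theorem a_int_mul (k : ℤ) (t : ℝ) : a (k * t) = a t ^ k := by
  let φ : Multiplicative ℝ →* G :=
    { toFun := fun t => a t.toAdd
      map_one' := a_zero
      map_mul' := fun s t => a_add _ _ }
  have := map_zpow φ (Multiplicative.ofAdd t) k
  rw [← ofAdd_zsmul, zsmul_eq_mul] at this
  exact this

theorem a_eq_one_iff (t : ℝ) : a t = 1 ↔ t = 0 := by
  refine ⟨fun h => ?_, fun h => h ▸ a_zero⟩
  have := im_p_a t
  rw [h, p, one_smul, UpperHalfPlane.I_im] at this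
  exact (Real.exp_eq_one_iff t).mp this.symm

/-- Since `Γ` is discrete, the least positive period is attained. -/
theorem ClosedGeodesic.length_spec [DiscreteTopology Γ] (C : ClosedGeodesic Γ) :
    0 < C.length ∧ C.frame * a C.length * C.frame⁻¹ ∈ Γ := by
  set g := C.frame
  have hcont : Continuous fun t => g * a t * g⁻¹ :=
    (continuous_const.mul continuous_a).mul continuous_const
  have hΓ : IsClosed (Γ : Set G) := Subgroup.isClosed_of_discrete
  obtain ⟨V, hV, hVΓ⟩ : ∃ V : Set G, IsOpen V ∧ V ∩ Γ = {1} := by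
    obtain ⟨V, hV, hV'⟩ := isOpen_induced_iff.mp (isOpen_discrete ({1} : Set Γ))
    refine ⟨V, hV, ?_⟩
    ext x
    constructor
    · rintro ⟨hx, hxΓ⟩
      have : (⟨x, hxΓ⟩ : Γ) ∈ (Subtype.val ⁻¹' V : Set Γ) := hx
      rw [hV'] at this
      exact congrArg Subtype.val this
    · rintro rfl
      have : (1 : Γ) ∈ (Subtype.val ⁻¹' V : Set Γ) := by rw [hV']; rfl
      exact ⟨this, Γ.one_mem⟩
  have h1V : (1 : G) ∈ V := (hVΓ.symm ▸ rfl : (1 : G) ∈ V ∩ Γ).1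
  have hev : ∀ᶠ t in 𝓝 (0 : ℝ), g * a t * g⁻¹ ∈ V :=
    hcont.continuousAt.eventually (hV.mem_nhds (by simpa [a_zero] using h1V))
  obtain ⟨ε, hε, hball⟩ := Metric.eventually_nhds_iff.mp hev
  have hlow : ∀ t, 0 < t → g * a t * g⁻¹ ∈ Γ → ε ≤ t := by
    intro t ht hΓt
    by_contra! hlt
    have hmem : g * a t * g⁻¹ ∈ V ∩ Γ := by
      refine ⟨hball ?_, hΓt⟩
      rwa [Real.dist_eq, sub_zero, abs_of_pos ht]
    rw [hVΓ, mem_singleton_iff, mul_inv_eq_one, mul_eq_left, a_eq_one_iff] at hmem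
    exact ht.ne' hmem
  have hS : {t : ℝ | 0 < t ∧ g * a t * g⁻¹ ∈ Γ} =
      Ici ε ∩ (fun t => g * a t * g⁻¹) ⁻¹' (Γ : Set G) := by
    ext t
    exact ⟨fun h => ⟨hlow t h.1 h.2, h.2⟩, fun h => ⟨hε.trans_le h.1, h.2⟩⟩
  have hmem : sInf {t : ℝ | 0 < t ∧ g * a t * g⁻¹ ∈ Γ} ∈
      {t : ℝ | 0 < t ∧ g * a t * g⁻¹ ∈ Γ} := by
    refine IsClosed.csInf_mem ?_ C.closed ⟨0, fun t ht => ht.1.le⟩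
    rw [hS]
    exact isClosed_Ici.inter (hΓ.preimage hcont)
  exact hmem

theorem measurable_projY : Measurable (projY Γ) := measurable_quotient_mk''

theorem measurable_projT : Measurable (projT Γ) := measurable_quotient_mk''

theorem projY_smul {γ : G} (hγ : γ ∈ Γ) (z : ℍ) : projY Γ (γ • z) = projY Γ z :=
  Quotient.sound ⟨⟨γ, hγ⟩, rfl⟩

theorem projT_mul {γ : G} (hγ : γ ∈ Γ) (g : G) : projT Γ (γ * g) = projT Γ g :=
  Quotient.sound ⟨⟨γ, hγ⟩, rfl⟩

theorem preimage_image_projY (A : Set ℍ) :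
    projY Γ ⁻¹' (projY Γ '' A) = ⋃ γ : Γ, (fun z => (γ : G) • z) ⁻¹' A := by
  ext z
  simp only [mem_preimage, mem_image, mem_iUnion]
  constructor
  · rintro ⟨w, hw, hwz⟩
    obtain ⟨γ, hγ⟩ := Quotient.exact hwz
    have e : (γ : G) • z = w := hγ
    exact ⟨γ, by rwa [e]⟩
  · rintro ⟨γ, hγ⟩
    exact ⟨_, hγ, projY_smul γ.2 z⟩

theorem measurableSet_image_projY [DiscreteTopology Γ] {A : Set ℍ} (hA : MeasurableSet A) :
    MeasurableSet (projY Γ '' A) := by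
  have := countable_of_discrete (Γ := Γ)
  change MeasurableSet (projY Γ ⁻¹' (projY Γ '' A))
  rw [preimage_image_projY]
  exact MeasurableSet.iUnion fun γ => (continuous_const_smul (γ : G)).measurable hA

/-- The tiles of `C` through which the geodesic runs from `I` to `J`. -/
def ClosedGeodesic.crossedTiles (C : ClosedGeodesic Γ) (F I J : Set ℍ) : Set G :=
  {γ | γ ∈ C.tiles F ∧ ∃ r : ℝ, γ⁻¹ * C.frame * a r ∈ innerCrossing F I J}

/-- The parameters within one period at which the closed geodesic runs from `I` to `J` through a
translate of the polygon. -/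
def ClosedGeodesic.crossingTimes (C : ClosedGeodesic Γ) (F I J : Set ℍ) : Set ℝ :=
  {t | t ∈ Ioc 0 C.length ∧ ∃ γ ∈ Γ, γ⁻¹ * C.frame * a t ∈ innerCrossing F I J}

/-- Every crossing of a translate of the polygon has a representative modulo the period that is
entered during the first period, so each of the `crossedTiles` accounts for at most one crossing
time. -/
theorem ClosedGeodesic.volume_crossingTimes_le [DiscreteTopology Γ]
    (hF : IsFundamentalPolygon Γ F) {I J : Set ℍ} (hI : IsBoundaryArc F I)
    (hJ : IsBoundaryArc F J) (C : ClosedGeodesic Γ) :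
    volume (C.crossingTimes F I J) ≤ ∑' _ : C.crossedTiles F I J, maxCrossingLength I J := by
  have := countable_of_discrete (Γ := Γ)
  obtain ⟨hl, hlΓ⟩ := C.length_spec
  set g := C.frame with hg
  set l := C.length with hl'
  let T : G → Set ℝ := fun γ => {r : ℝ | γ⁻¹ * g * a r ∈ innerCrossing F I J}
  have hper : ∀ (k : ℤ) (δ : G) (u : ℝ),
      ((g * a l * g⁻¹) ^ (-k) * δ)⁻¹ * g * a u = δ⁻¹ * g * a (u + k * l) := by
    intro k δ u
    rw [conj_zpow, zpow_neg, ← a_int_mul, add_comm, a_add]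
    group
  -- a crossing that starts at time `s` is shifted by `⌊s / l⌋` periods
  have hcover : C.crossingTimes F I J ⊆ ⋃ γ : C.crossedTiles F I J,
      ⋃ m : AddSubgroup.zmultiples l, ((m +ᵥ T γ) ∩ Ioc 0 (0 + l)) := by
    rintro t ⟨ht, δ, hδ, hδt⟩
    obtain ⟨s, t', hst, htt', hs, ht', hiff, -⟩ := exists_of_mem_innerCrossing hF hI.1 hJ.1 hδt
    set k : ℤ := ⌊s / l⌋
    have hk1 : k * l ≤ s := by
      rw [← le_div_iff₀ hl]; exact Int.floor_le _
    have hk2 : s < k * l + l := by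
      have := Int.lt_floor_add_one (s / l)
      rw [div_lt_iff₀ hl] at this
      linarith
    set γ := (g * a l * g⁻¹) ^ (-k) * δ with hγ
    have hγΓ : γ ∈ Γ := Γ.mul_mem (Γ.zpow_mem hlΓ _) hδ
    have hp : ∀ u, p (g * a u) ∈ γ • F ↔ p (δ⁻¹ * g * a (u + k * l)) ∈ F := by
      intro u
      rw [mem_smul_set_iff_inv_smul_mem, ← p_mul, ← mul_assoc, hper]
    have hT : t - k * l ∈ T γ := by
      change γ⁻¹ * g * a (t - k * l) ∈ innerCrossing F I J
      rw [hper, sub_add_cancel]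
      exact hδt
    refine mem_iUnion.mpr ⟨⟨γ, ⟨hγΓ, s - k * l, ⟨by linarith, by linarith⟩, ?_, ?_⟩, _, hT⟩,
      mem_iUnion.mpr ⟨⟨(k : ℤ) * l, ⟨k, by simp⟩⟩, ?_, by simpa using ht⟩⟩
    · rw [hp, sub_add_cancel, hiff]
      simp
    · filter_upwards [Ioo_mem_nhdsGT (show s - k * l < t' - k * l by linarith)] with u hu
      rw [hp, hiff]
      exact ⟨by linarith [hu.1], by linarith [hu.2]⟩
    · exact ⟨t - k * l, hT, by simp [AddSubgroup.vadd_def]⟩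
  have hct : Countable (C.crossedTiles F I J) := by
    have : (C.crossedTiles F I J) ⊆ (Γ : Set G) := fun γ hγ => hγ.1.1
    exact (Set.Countable.mono this (Set.to_countable _)).to_subtype
  have hfd := isAddFundamentalDomain_Ioc hl 0 (μ := (volume : Measure ℝ))
  calc volume (C.crossingTimes F I J)
      ≤ volume (⋃ γ : C.crossedTiles F I J,
          ⋃ m : AddSubgroup.zmultiples l, ((m +ᵥ T γ) ∩ Ioc 0 (0 + l))) := measure_mono hcover
    _ ≤ ∑' γ : C.crossedTiles F I J,
          volume (⋃ m : AddSubgroup.zmultiples l, ((m +ᵥ T γ) ∩ Ioc 0 (0 + l))) :=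
        measure_iUnion_le _
    _ ≤ ∑' γ : C.crossedTiles F I J, ∑' m : AddSubgroup.zmultiples l,
          volume ((m +ᵥ T γ) ∩ Ioc 0 (0 + l)) :=
        ENNReal.tsum_le_tsum fun γ => measure_iUnion_le _
    _ = ∑' γ : C.crossedTiles F I J, volume (T γ) := by
        congr 1
        ext γ
        exact (hfd.measure_eq_tsum (T γ)).symm
    _ ≤ _ := ENNReal.tsum_le_tsum fun γ => volume_innerCrossing_le hF hI.1 hJ.1 _

/-- Each of the `crossedTiles` contributes at least the gap area to the partial covering: by
`leftSide_gapChord_subset` its part to the left of the lift projects onto the image of every cap. -/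
theorem ClosedGeodesic.tsum_gapArea_le [DiscreteTopology Γ]
    (hF : IsFundamentalPolygon Γ F) {I J : Set ℍ} (hI : IsBoundaryArc F I)
    (hJ : IsBoundaryArc F J) (hIJ : Disjoint I J) (C : ClosedGeodesic Γ) :
    ∑' _ : C.crossedTiles F I J, gapArea F I J ≤ ∫⁻ x, partialCovering F C x ∂(areaY Γ F) := by
  have := countable_of_discrete (Γ := Γ)
  have hct : Countable (C.tiles F) := by
    have : (C.tiles F) ⊆ (Γ : Set G) := fun γ hγ => hγ.1
    exact (Set.Countable.mono this (Set.to_countable _)).to_subtype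
  let A : G → Set ℍ := fun γ => leftSide C.frame ∩ γ • F
  have hA : ∀ γ, MeasurableSet (projY Γ '' A γ) := fun γ => measurableSet_image_projY
    ((isClosed_leftSide _).measurableSet.inter (hF.isOpen.smul γ).measurableSet)
  calc ∑' _ : C.crossedTiles F I J, gapArea F I J
      ≤ ∑' γ : C.crossedTiles F I J, areaY Γ F (projY Γ '' A γ) := by
        refine ENNReal.tsum_le_tsum fun γ => ?_
        obtain ⟨r, hr⟩ := γ.2.2
        refine iSup₂_le fun h hh => ?_
        rw [areaY, Measure.map_apply measurable_projY (hA _),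
          Measure.restrict_apply (measurable_projY (hA _))]
        refine measure_mono fun z hz => ⟨?_, hz.2⟩
        have hz1 := leftSide_gapChord_subset hF hI hJ hIJ hh hr hz
        rw [leftSide_mul_a, ← smul_leftSide, mem_smul_set_iff_inv_smul_mem, inv_inv] at hz1
        exact ⟨(γ : G) • z, ⟨hz1, smul_mem_smul_set hz.2⟩, projY_smul γ.2.1.1 z⟩
    _ ≤ ∑' γ : C.tiles F, areaY Γ F (projY Γ '' A γ) :=
        ENNReal.tsum_mono_subtype (fun γ => areaY Γ F (projY Γ '' A γ)) fun γ hγ => hγ.1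
    _ = ∑' γ : C.tiles F, ∫⁻ x, (projY Γ '' A γ).indicator 1 x ∂(areaY Γ F) := by
        congr 1
        ext γ
        rw [lintegral_indicator_one (hA _)]
    _ = ∫⁻ x, ∑' γ : C.tiles F, (projY Γ '' A γ).indicator 1 x ∂(areaY Γ F) :=
        (lintegral_tsum fun γ => (measurable_one.indicator (hA _)).aemeasurable).symm
    _ ≤ ∫⁻ x, partialCovering F C x ∂(areaY Γ F) := by
        refine lintegral_mono fun x => ENNReal.tsum_le_tsum fun γ => ?_
        by_cases hx : x ∈ projY Γ '' A γ
        swap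
        · rw [indicator_of_notMem hx]
          exact zero_le
        rw [indicator_of_mem hx]
        obtain ⟨z, hz, rfl⟩ := hx
        have h1 : 1 ≤ (projY Γ ⁻¹' {projY Γ z} ∩ A γ).encard :=
          one_le_encard_iff_nonempty.mpr ⟨z, rfl, hz⟩
        rw [Pi.one_apply]
        exact_mod_cast h1

/-- Every crossing of the polygon from `I` to `J` takes at most the time `L = maxCrossingLength I J`
and contributes at least `gapArea F I J` to the volume of the partial covering. -/
theorem gapArea_mul_crossingTimes_le [DiscreteTopology Γ]
    (hF : IsFundamentalPolygon Γ F) {I J : Set ℍ} (hI : IsBoundaryArc F I)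
    (hJ : IsBoundaryArc F J) (hIJ : Disjoint I J) (S : Multiset (ClosedGeodesic Γ)) :
    gapArea F I J * (S.map fun C => volume (C.crossingTimes F I J)).sum ≤
      maxCrossingLength I J * volCovering F S := by
  unfold volCovering
  induction S using Multiset.induction_on with
  | empty => simp
  | cons C S ih =>
    simp only [Multiset.map_cons, Multiset.sum_cons, mul_add]
    have h1 : gapArea F I J * volume (C.crossingTimes F I J) ≤
        maxCrossingLength I J * ∫⁻ x, partialCovering F C x ∂(areaY Γ F) :=
      calc gapArea F I J * volume (C.crossingTimes F I J)
          ≤ gapArea F I J * ∑' _ : C.crossedTiles F I J, maxCrossingLength I J := by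
            gcongr
            exact C.volume_crossingTimes_le hF hI hJ
        _ = maxCrossingLength I J * ∑' _ : C.crossedTiles F I J, gapArea F I J := by
            rw [← ENNReal.tsum_mul_left, ← ENNReal.tsum_mul_left]
            simp_rw [mul_comm]
        _ ≤ _ := by
            gcongr
            exact C.tsum_gapArea_le hF hI hJ hIJ
    refine (add_le_add h1 ih).trans ?_
    rw [← mul_add]
    gcongr
    exact le_lintegral_add _ _

end Counting

/-! ### The Haar measure in Iwasawa coordinates -/

theorem continuous_rot : Continuous rot := by
  refine continuous_induced_rng.mpr ?_
  refine continuous_matrix fun i j => ?_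
  fin_cases i <;> fin_cases j <;> simp <;> fun_prop

theorem continuous_iwasawa : Continuous fun q : ℍ × ℝ => iwasawa q.1 q.2 :=
  continuous_toG.comp ((UpperHalfPlane.continuous_toSL2R.comp continuous_fst).mul
    (continuous_rot.comp continuous_snd))

theorem p_iwasawa (z : ℍ) (θ : ℝ) : p (iwasawa z θ) = z := by
  rw [p, iwasawa, toG_smul, mul_smul, rot_smul_I, UpperHalfPlane.toSL2R_smul_I]

theorem haarG_preimage_p {s : Set ℍ} (hs : MeasurableSet s) : haarG (p ⁻¹' s) = volume s := by
  have hpi : ENNReal.ofReal Real.pi ≠ 0 := by simpa using Real.pi_pos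
  rw [haarG, Measure.map_apply continuous_iwasawa.measurable (continuous_p.measurable hs)]
  have : (fun q : ℍ × ℝ => iwasawa q.1 q.2) ⁻¹' (p ⁻¹' s) = s ×ˢ univ := by
    ext q
    simp [p_iwasawa]
  rw [this, Measure.prod_prod]
  simp only [Measure.smul_apply, Measure.restrict_apply_univ, Real.volume_Ioc, sub_zero,
    smul_eq_mul]
  rw [ENNReal.inv_mul_cancel hpi ENNReal.ofReal_ne_top, mul_one]

theorem rot_add_pi (θ : ℝ) : rot (θ + Real.pi) = -rot θ := by
  apply Subtype.ext
  rw [Matrix.SpecialLinearGroup.coe_neg]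
  ext i j
  fin_cases i <;> fin_cases j <;> simp [rot]

theorem iwasawa_add_int_mul_pi (z : ℍ) (θ : ℝ) (n : ℤ) :
    iwasawa z (θ + n * Real.pi) = iwasawa z θ := by
  have hper : Function.Periodic (iwasawa z) Real.pi := by
    intro θ
    rw [iwasawa, iwasawa, rot_add_pi, mul_neg, toG_neg]
  exact hper.int_mul n θ

/-- The elements fixing `i` are rotations. -/
theorem exists_rot_of_smul_I {A : SL(2, ℝ)} (hA : A • UpperHalfPlane.I = UpperHalfPlane.I) :
    ∃ θ, A = rot θ := by
  have hdet := A.det_coe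
  rw [Matrix.det_fin_two] at hdet
  have hre := congrArg UpperHalfPlane.re hA
  have him := congrArg UpperHalfPlane.im hA
  have hpos := normSq_denom_pos A UpperHalfPlane.I
  rw [re_smul_SL, UpperHalfPlane.I_re, UpperHalfPlane.I_im, div_eq_zero_iff] at hre
  rw [im_smul_SL, UpperHalfPlane.I_im] at him
  rw [UpperHalfPlane.I_im] at hpos
  have h1 : (A 1 0) ^ 2 + (A 1 1) ^ 2 = 1 := by
    rw [div_eq_one_iff_eq hpos.ne'] at him
    rw [UpperHalfPlane.I_re] at him
    linarith
  have h2 : A 0 0 * A 1 0 + A 0 1 * A 1 1 = 0 := by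
    rcases hre with h | h
    · linarith
    · rw [UpperHalfPlane.I_re] at hpos; exact absurd h hpos.ne'
  have h3 : A 0 0 = A 1 1 := by linear_combination (-A 0 0) * h1 + A 1 0 * h2 + A 1 1 * hdet
  have h4 : A 0 1 = -A 1 0 := by linear_combination (-A 0 1) * h1 + A 1 1 * h2 - A 1 0 * hdet
  set ζ : ℂ := ⟨A 1 1, -A 1 0⟩ with hζ
  have hnorm : ‖ζ‖ = 1 := by
    rw [Complex.norm_def, Complex.normSq_apply]
    simp only [hζ]
    rw [Real.sqrt_eq_one]
    linarith
  have hζ0 : ζ ≠ 0 := by rw [← norm_ne_zero_iff, hnorm]; exact one_ne_zero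
  have hc : Real.cos ζ.arg = A 1 1 := by rw [Complex.cos_arg hζ0, hnorm, div_one]
  have hs : Real.sin ζ.arg = -A 1 0 := by rw [Complex.sin_arg, hnorm, div_one]
  obtain ⟨r1, r2, r3, r4⟩ := rot_entries ζ.arg
  refine ⟨ζ.arg, ?_⟩
  ext i j
  fin_cases i <;> fin_cases j
  · exact h3.trans (hc.symm.trans r1.symm)
  · exact h4.trans (hs.symm.trans r2.symm)
  · exact (by rw [r3, hs, neg_neg] : rot ζ.arg 1 0 = A 1 0).symm
  · exact hc.symm.trans r4.symm

theorem exists_iwasawa (g : G) : ∃ θ ∈ Ioc 0 Real.pi, iwasawa (p g) θ = g := by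
  obtain ⟨A, rfl⟩ := toG_surjective g
  obtain ⟨θ, hθ⟩ := exists_rot_of_smul_I (A := (p (toG A)).toSL2R⁻¹ * A) (by
    rw [mul_smul, inv_smul_eq_iff, UpperHalfPlane.toSL2R_smul_I]
    rfl)
  have h : iwasawa (p (toG A)) θ = toG A := by rw [iwasawa, ← hθ, mul_inv_cancel_left]
  refine ⟨toIocMod Real.pi_pos 0 θ, by simpa using toIocMod_mem_Ioc Real.pi_pos 0 θ, ?_⟩
  have e : toIocMod Real.pi_pos 0 θ = θ + ((-toIocDiv Real.pi_pos 0 θ : ℤ) : ℝ) * Real.pi := by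
    rw [toIocMod]
    push_cast
    rw [zsmul_eq_mul]
    ring
  rw [e, iwasawa_add_int_mul_pi, h]

theorem haarG_pos_of_isOpen {O : Set G} (hO : IsOpen O) (hne : O.Nonempty) : 0 < haarG O := by
  obtain ⟨g, hg⟩ := hne
  obtain ⟨θ, hθ, hgθ⟩ := exists_iwasawa g
  rw [haarG, Measure.map_apply continuous_iwasawa.measurable hO.measurableSet]
  have hW : IsOpen ((fun q : ℍ × ℝ => iwasawa q.1 q.2) ⁻¹' O) := hO.preimage continuous_iwasawa
  obtain ⟨U, V, hU, hV, hzU, hθV, hUV⟩ := isOpen_prod_iff.mp hW (p g) θ (by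
    rw [mem_preimage]; simpa only [hgθ] using hg)
  refine lt_of_lt_of_le ?_ (measure_mono hUV)
  rw [Measure.prod_prod]
  refine ENNReal.mul_pos (hU.measure_pos volume ⟨_, hzU⟩).ne' ?_
  have hV' : (V ∩ Ioo 0 Real.pi).Nonempty := by
    refine mem_closure_iff.mp ?_ V hV hθV
    rw [closure_Ioo Real.pi_pos.ne]
    exact ⟨hθ.1.le, hθ.2⟩
  rw [Measure.smul_apply, Measure.restrict_apply hV.measurableSet, smul_eq_mul]
  refine (ENNReal.mul_pos (ENNReal.inv_ne_zero.mpr ENNReal.ofReal_ne_top) ?_).ne'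
  refine (((hV.inter isOpen_Ioo).measure_pos volume hV').trans_le
    (measure_mono (inter_subset_inter_right _ Ioo_subset_Ioc_self))).ne'

theorem exists_compact_subset_lt_haarG {O : Set G} (hO : IsOpen O) {r : ℝ≥0∞} (hr : r < haarG O) :
    ∃ K ⊆ O, IsCompact K ∧ r < haarG K := by
  have : LocallyCompactSpace O := hO.locallyCompactSpace
  let e := CompactExhaustion.choice O
  have hU : ⋃ n, Subtype.val '' e n = O := by
    rw [← image_iUnion, e.iUnion_eq, image_univ, Subtype.range_coe]
  have hmono : Monotone fun n => (Subtype.val '' e n : Set G) :=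
    fun m n hmn => image_mono (e.subset hmn)
  rw [← hU, hmono.measure_iUnion] at hr
  obtain ⟨n, hn⟩ := lt_iSup_iff.mp hr
  exact ⟨_, by rintro _ ⟨x, -, rfl⟩; exact x.2, (e.isCompact n).image continuous_subtype_val, hn⟩

/-! ### Test functions -/

/-- The matrix entries of an element of `SL(2, ℝ)`. -/
def entries (A : SL(2, ℝ)) : Fin 2 → Fin 2 → ℝ := fun i j => A i j

theorem isClosedEmbedding_entries : IsClosedEmbedding entries :=
  Matrix.SpecialLinearGroup.isClosedEmbedding_val

/-- The coordinate chart `(x, u, θ) ↦ iwasawa (x + i e^u) θ` lifted to `SL(2, ℝ)`. -/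
noncomputable def chartSL (v : ℝ × ℝ × ℝ) : SL(2, ℝ) :=
  (⟨⟨v.1, Real.exp v.2.1⟩, Real.exp_pos v.2.1⟩ : ℍ).toSL2R * rot v.2.2

theorem contDiff_entries_mul_chartSL (B : SL(2, ℝ)) :
    ContDiff ℝ ∞ fun v => entries (B * chartSL v) := by
  have hsq : ContDiff ℝ ∞ fun v : ℝ × ℝ × ℝ => √(Real.exp v.2.1) :=
    ContDiff.sqrt (by fun_prop) fun v => (Real.exp_pos _).ne'
  have hne : ∀ v : ℝ × ℝ × ℝ, √(Real.exp v.2.1) ≠ 0 := fun v =>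
    (Real.sqrt_pos.mpr (Real.exp_pos _)).ne'
  have h : (fun v => entries (B * chartSL v)) = fun v i j =>
      B i 0 * (√(Real.exp v.2.1) * rot v.2.2 0 j + v.1 / √(Real.exp v.2.1) * rot v.2.2 1 j) +
        B i 1 * (1 / √(Real.exp v.2.1) * rot v.2.2 1 j) := by
    funext v i j
    simp only [entries, chartSL, Matrix.SpecialLinearGroup.coe_mul, Matrix.mul_apply,
      Fin.sum_univ_two, UpperHalfPlane.coe_toSL2R]
    simp [UpperHalfPlane.im, UpperHalfPlane.re]
  have hrot : ∀ i j, ContDiff ℝ ∞ fun v : ℝ × ℝ × ℝ => rot v.2.2 i j := by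
    intro i j
    fin_cases i <;> fin_cases j <;> simp [rot] <;> fun_prop
  rw [h]
  refine contDiff_pi.mpr fun i => contDiff_pi.mpr fun j => ?_
  have h0 := hrot 0 j
  have h1 := hrot 1 j
  exact (contDiff_const.mul ((hsq.mul h0).add ((contDiff_fst.div hsq hne).mul h1))).add
    (contDiff_const.mul ((contDiff_const.div hsq hne).mul h1))

/-- Smooth bump functions on `G`, obtained by averaging a smooth function of the matrix entries
over `± A`. -/
theorem exists_bump {K O : Set G} (hK : IsCompact K) (hO : IsOpen O) (hKO : K ⊆ O) :
    ∃ (f : G → ℝ) (L : Set G), IsCompact L ∧ L ⊆ O ∧ Continuous f ∧ (∀ g, 0 ≤ f g ∧ f g ≤ 1) ∧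
      (∀ g ∈ K, f g = 1) ∧ (∀ g ∉ L, f g = 0) ∧
      ∀ h : G, ContDiff ℝ ∞ fun v => f (h * toG (chartSL v)) := by
  obtain ⟨V, hV, hKV, hVO, hVc⟩ := exists_open_between_and_isCompact_closure hK hO hKO
  have hs : IsClosed (entries '' (toG ⁻¹' Vᶜ)) :=
    isClosedEmbedding_entries.isClosedMap _ (hV.isClosed_compl.preimage continuous_toG)
  have ht : IsClosed (entries '' (toG ⁻¹' K)) :=
    isClosedEmbedding_entries.isClosedMap _ (hK.isClosed.preimage continuous_toG)
  have hd : Disjoint (entries '' (toG ⁻¹' Vᶜ)) (entries '' (toG ⁻¹' K)) := by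
    rw [disjoint_image_iff isClosedEmbedding_entries.injective]
    exact Disjoint.preimage _ (disjoint_compl_left_iff_subset.mpr hKV)
  obtain ⟨φ, hφ0, hφ1, hφ⟩ := exists_contMDiffMap_zero_one_of_isClosed (n := ⊤)
    (modelWithCornersSelf ℝ (Fin 2 → Fin 2 → ℝ)) hs ht hd
  have hφs : ContDiff ℝ ∞ φ := φ.contMDiff.contDiff
  let f : G → ℝ := fun g => (φ (entries (Quotient.out g)) + φ (-entries (Quotient.out g))) / 2
  have hf : ∀ A : SL(2, ℝ), f (toG A) = (φ (entries A) + φ (-entries A)) / 2 := by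
    intro A
    have hout : toG (Quotient.out (toG A)) = toG A := Quotient.out_eq _
    rcases (toG_eq_iff _ _).mp hout with h | h
    · simp only [f]
      rw [h]
    · have e : entries (-A) = -entries A := by
        funext i j; simp [entries]
      simp only [f]
      rw [h, e, neg_neg, add_comm]
  have hneg : ∀ A, -entries A = entries (-A) := fun A => by funext i j; simp [entries]
  refine ⟨f, closure V, hVc, hVO, ?_, ?_, ?_, ?_, ?_⟩
  · rw [(QuotientGroup.isQuotientMap_mk (N := Subgroup.center SL(2, ℝ))).continuous_iff]
    have : (f ∘ QuotientGroup.mk) = fun A : SL(2, ℝ) => (φ (entries A) + φ (-entries A)) / 2 :=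
      funext hf
    rw [this]
    have h1 := hφs.continuous
    have h2 := isClosedEmbedding_entries.continuous
    fun_prop
  · intro g
    obtain ⟨A, rfl⟩ := toG_surjective g
    rw [hf]
    have h1 := hφ (entries A)
    have h2 := hφ (-entries A)
    constructor <;> linarith [h1.1, h1.2, h2.1, h2.2]
  · intro g hg
    obtain ⟨A, rfl⟩ := toG_surjective g
    rw [hf, hneg, hφ1 (mem_image_of_mem _ hg),
      hφ1 (mem_image_of_mem _ (show toG (-A) ∈ K by rwa [toG_neg]))]
    norm_num
  · intro g hg
    obtain ⟨A, rfl⟩ := toG_surjective g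
    have hg' : toG A ∈ Vᶜ := fun h => hg (subset_closure h)
    rw [hf, hneg, hφ0 (mem_image_of_mem _ hg'),
      hφ0 (mem_image_of_mem _ (show toG (-A) ∈ Vᶜ by rwa [toG_neg]))]
    simp
  · intro h
    obtain ⟨B, rfl⟩ := toG_surjective h
    simp_rw [← toG_mul, hf]
    have h1 := contDiff_entries_mul_chartSL B
    exact ((hφs.comp h1).add (hφs.comp h1.neg)).div_const 2

section TestFunction

variable {Γ : Subgroup G} {F : Set ℍ}

theorem haarT_integral (ψ : UnitTangent Γ → ℝ) (hψ : Measurable ψ) :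
    ∫ q, ψ q ∂(haarT Γ F) = ∫ g in p ⁻¹' F, ψ (projT Γ g) ∂haarG :=
  integral_map measurable_projT.aemeasurable hψ.aestronglyMeasurable

/-- The indicator function of the image in `Γ \ G` of an open subset of `p⁻¹(F)` is approximated
from below by smooth functions of compact support. -/
theorem exists_testFunction [DiscreteTopology Γ] (hF : IsFundamentalPolygon Γ F)
    (hvol : (volume : Measure ℍ) F ≠ ⊤) {O : Set G} (hO : IsOpen O) (hOF : O ⊆ p ⁻¹' F)
    {r : ℝ≥0∞} (hr : r < haarG O) :
    ∃ ψ : UnitTangent Γ → ℝ, SmoothOnG (fun g => ((ψ (projT Γ g) : ℝ) : ℂ)) ∧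
      HasCompactSupport (fun q => ((ψ q : ℝ) : ℂ)) ∧ Measurable ψ ∧
      (∀ q, 0 ≤ ψ q ∧ ψ q ≤ 1) ∧ (∀ g, ψ (projT Γ g) ≠ 0 → ∃ γ ∈ Γ, γ * g ∈ O) ∧
      r < ENNReal.ofReal (∫ g in p ⁻¹' F, ψ (projT Γ g) ∂haarG) := by
  obtain ⟨K, hKO, hK, hrK⟩ := exists_compact_subset_lt_haarG hO hr
  obtain ⟨f, L, hL, hLO, hfc, hf01, hf1, hf0, hfs⟩ := exists_bump hK hO hKO
  have htend := Γ.tendsto_coe_cofinite_of_discrete ⟨inferInstance⟩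
  have hpd : ProperlyDiscontinuousSMul Γ G :=
    Γ.properlyDiscontinuousSMul_of_tendsto_cofinite htend
  have hT2 : T2Space (UnitTangent Γ) := t2Space_of_properlyDiscontinuousSMul_of_t2Space
  have hpc : Continuous (projT Γ) := continuous_quotient_mk'
  let ψ : UnitTangent Γ → ℝ := fun q => ∑ᶠ γ : Γ, f (γ * Quotient.out q)
  have hψ : ∀ g, ψ (projT Γ g) = ∑ᶠ γ : Γ, f (γ * g) := by
    intro g
    obtain ⟨δ, hδ⟩ := Quotient.exact (Quotient.out_eq (projT Γ g))
    have hδ' : (δ : G) * g = Quotient.out (projT Γ g) := hδ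
    simp only [ψ]
    rw [← hδ']
    simp_rw [← mul_assoc]
    exact finsum_comp_equiv (Equiv.mulRight δ) (f := fun γ : Γ => f (γ * g))
  have hfO : ∀ g, f g ≠ 0 → g ∈ O := fun g hg => hLO (by
    by_contra h
    exact hg (hf0 g h))
  -- at most one term of the sum is non-zero
  have hone : ∀ g (γ : Γ), f (γ * g) ≠ 0 → ψ (projT Γ g) = f (γ * g) := by
    intro g γ hγ
    rw [hψ]
    refine finsum_eq_single _ γ fun δ hδ => ?_
    by_contra hne
    apply hδ
    have h1 : p (γ * g) ∈ F := hOF (hfO _ hγ)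
    have h2 : p (δ * g) ∈ F := hOF (hfO _ hne)
    have h3 := hF.eq_one_of_mem (γ := (δ : G) * (γ : G)⁻¹) (Γ.mul_mem δ.2 (Γ.inv_mem γ.2)) h1 (by
      rw [← p_mul]
      simpa [mul_assoc] using h2)
    exact Subtype.ext (mul_inv_eq_one.mp h3)
  have hzero : ∀ g, (∀ γ : Γ, f (γ * g) = 0) → ψ (projT Γ g) = 0 := by
    intro g hg
    rw [hψ]
    simp [hg]
  -- locally, `ψ` is a finite sum
  have hloc : ∀ g₀, ∃ s : Finset Γ, ∀ᶠ g in 𝓝 g₀, ψ (projT Γ g) = ∑ γ ∈ s, f (γ * g) := by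
    intro g₀
    obtain ⟨N, hN, hg₀⟩ := exists_compact_mem_nhds g₀
    have hfin := hpd.finite_disjoint_inter_image hN hL
    refine ⟨hfin.toFinset, ?_⟩
    filter_upwards [hg₀] with g hg
    rw [hψ]
    refine finsum_eq_sum_of_support_subset _ fun γ hγ => ?_
    rw [Finite.coe_toFinset]
    refine ⟨γ * g, ⟨g, hg, rfl⟩, ?_⟩
    by_contra h
    exact hγ (hf0 _ h)
  have hcont : Continuous fun g => ψ (projT Γ g) := by
    refine continuous_iff_continuousAt.mpr fun g₀ => ?_
    obtain ⟨s, hs⟩ := hloc g₀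
    refine ContinuousAt.congr ?_ (hs.mono fun g hg => hg.symm)
    refine Continuous.continuousAt ?_
    exact continuous_finsetSum _ fun γ _ => hfc.comp (continuous_const.mul continuous_id)
  have hmeas : Measurable ψ := by
    have : Measurable fun g => ψ (projT Γ g) := hcont.measurable
    exact measurable_from_quotient.mpr this
  have hcase : ∀ g, ψ (projT Γ g) = 0 ∨ ∃ γ : Γ, f (γ * g) ≠ 0 ∧ ψ (projT Γ g) = f (γ * g) := by
    intro g
    by_cases h : ∀ γ : Γ, f (γ * g) = 0
    · exact Or.inl (hzero g h)
    · push Not at h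
      obtain ⟨γ, hγ⟩ := h
      exact Or.inr ⟨γ, hγ, hone g γ hγ⟩
  have h01 : ∀ q, 0 ≤ ψ q ∧ ψ q ≤ 1 := by
    intro q
    obtain ⟨g, rfl⟩ : ∃ g, projT Γ g = q := Quotient.exists_rep q
    rcases hcase g with h | ⟨γ, -, h⟩
    · rw [h]; simp
    · rw [h]; exact hf01 _
  refine ⟨ψ, ?_, ?_, hmeas, h01, ?_, ?_⟩
  · -- smoothness
    have hchart : Continuous fun v => toG (chartSL v) := by
      refine continuous_toG.comp (isClosedEmbedding_entries.isEmbedding.continuous_iff.mpr ?_)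
      simpa [Function.comp_def] using (contDiff_entries_mul_chartSL 1).continuous
    have hsm : ContDiff ℝ ∞ fun v => ψ (projT Γ (toG (chartSL v))) := by
      refine contDiff_iff_contDiffAt.mpr fun v₀ => ?_
      obtain ⟨s, hs⟩ := hloc (toG (chartSL v₀))
      refine ContDiffAt.congr_of_eventuallyEq ?_ (hchart.continuousAt.eventually hs)
      exact ContDiffAt.sum fun γ _ => (hfs γ).contDiffAt
    exact Complex.ofRealCLM.contDiff.comp hsm
  · refine HasCompactSupport.intro (hL.image hpc) fun q hq => ?_
    obtain ⟨g, rfl⟩ : ∃ g, projT Γ g = q := Quotient.exists_rep q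
    have : ψ (projT Γ g) = 0 := hzero g fun γ => by
      by_contra hne
      refine hq ⟨γ * g, ?_, projT_mul γ.2 g⟩
      by_contra h
      exact hne (hf0 _ h)
    simp [this]
  · intro g hg
    rcases hcase g with h | ⟨γ, hγ, -⟩
    · exact absurd h hg
    · exact ⟨γ, γ.2, hfO _ hγ⟩
  · refine hrK.trans_le ?_
    have hfin : haarG (p ⁻¹' F) ≠ ⊤ := by rwa [haarG_preimage_p hF.isOpen.measurableSet]
    have : IsFiniteMeasure (haarG.restrict (p ⁻¹' F)) := ⟨by
      rw [Measure.restrict_apply_univ]; exact hfin.lt_top⟩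
    have hKF : K ⊆ p ⁻¹' F := hKO.trans hOF
    rw [ofReal_integral_eq_lintegral_ofReal]
    · calc haarG K = (haarG.restrict (p ⁻¹' F)) K := by
            rw [Measure.restrict_apply hK.isClosed.measurableSet, inter_eq_left.mpr hKF]
        _ = ∫⁻ g in p ⁻¹' F, K.indicator 1 g ∂haarG :=
            (lintegral_indicator_one hK.isClosed.measurableSet).symm
        _ ≤ _ := by
            refine lintegral_mono fun g => ?_
            by_cases hg : g ∈ K
            · rw [indicator_of_mem hg]
              have h1 : f ((1 : Γ) * g) = 1 := by
                rw [OneMemClass.coe_one, one_mul]; exact hf1 g hg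
              have := hone g 1 (by rw [h1]; exact one_ne_zero)
              rw [this, h1]
              simp
            · rw [indicator_of_notMem hg]
              exact zero_le
    · refine Integrable.of_bound hcont.aestronglyMeasurable 1 (ae_of_all _ fun g => ?_)
      rw [Real.norm_eq_abs, abs_of_nonneg (h01 _).1]
      exact (h01 _).2
    · exact ae_of_all _ fun g => (h01 _).1

end TestFunction

/-! ### The lower bound for the covered volume -/

section LowerBound

variable {Γ : Subgroup G} {F : Set ℍ}

instance instInvariantSubgroup (Γ : Subgroup G) : SMulInvariantMeasure Γ ℍ volume where
  measure_preimage_smul γ _ hs := measure_preimage_smul_of_nullMeasurableSet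
    hs.nullMeasurableSet (γ : G)

theorem IsFundamentalPolygon.volume_lt_top [DiscreteTopology Γ] (hF : IsFundamentalPolygon Γ F)
    (hcof : IsCofinite Γ) : (volume : Measure ℍ) F < ⊤ := by
  obtain ⟨D, hD, hDvol⟩ := hcof
  have := countable_of_discrete (Γ := Γ)
  refine lt_of_le_of_lt ?_ hDvol
  refine hD.measure_le_of_pairwise_disjoint hF.isOpen.measurableSet.nullMeasurableSet ?_
  intro γ δ hne
  refine Disjoint.aedisjoint (Disjoint.mono inter_subset_left inter_subset_left ?_)
  rw [Set.disjoint_left]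
  rintro _ ⟨z, hz, rfl⟩ ⟨w, hw, hwz⟩
  apply hne
  have hwz' : (δ : G) • w = (γ : G) • z := hwz
  have h1 := hF.eq_one_of_mem (γ := (δ : G)⁻¹ * (γ : G)) (Γ.mul_mem (Γ.inv_mem δ.2) γ.2) hz (by
    rw [mul_smul, ← hwz', inv_smul_smul]
    exact hw)
  exact Subtype.ext (inv_mul_eq_one.mp h1).symm

theorem vol_eq (Γ : Subgroup G) (F : Set ℍ) : vol Γ F = volume F := by
  rw [vol, areaY, Measure.map_apply measurable_projY MeasurableSet.univ]
  simp

theorem IsFundamentalPolygon.volume_pos (hF : IsFundamentalPolygon Γ F) :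
    0 < (volume : Measure ℍ) F :=
  hF.isOpen.measure_pos volume hF.isConnected.nonempty

theorem gapArea_le (F I J : Set ℍ) : gapArea F I J ≤ volume F :=
  iSup₂_le fun _ _ => measure_mono inter_subset_right

theorem haarG_crossing (hF : IsFundamentalPolygon Γ F) {I J : Set ℍ} (hI : I ⊆ frontier F)
    (hJ : J ⊆ frontier F) : haarG (crossing I J) = haarG (innerCrossing F I J) := by
  refine le_antisymm ?_ (measure_mono inter_subset_left)
  refine (measure_mono (crossing_subset hF hI hJ)).trans ((measure_union_le _ _).trans ?_)
  rw [haarG_preimage_p isClosed_frontier.measurableSet, hF.volume_frontier, add_zero]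

theorem ofReal_multiset_sum_le {α : Type*} (S : Multiset α) {f : α → ℝ} {g : α → ℝ≥0∞}
    (h : ∀ x, ENNReal.ofReal (f x) ≤ g x) :
    ENNReal.ofReal (S.map f).sum ≤ (S.map g).sum := by
  induction S using Multiset.induction_on with
  | empty => simp
  | cons x S ih =>
    simp only [Multiset.map_cons, Multiset.sum_cons]
    exact ENNReal.ofReal_add_le.trans (add_le_add (h x) ih)

theorem ClosedGeodesic.integral_measure (C : ClosedGeodesic Γ) {ψ : UnitTangent Γ → ℝ}
    (hψ : Measurable ψ) :
    ∫ q, ψ q ∂C.measure = ∫ t in Ioc 0 C.length, ψ (projT Γ (C.frame * a t)) :=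
  integral_map (measurable_projT.comp
    (continuous_const.mul continuous_a).measurable).aemeasurable hψ.aestronglyMeasurable

/-- A test function bounded by the indicator function of the image of `innerCrossing F I J` in
`Γ \ G` integrates over a closed geodesic to at most its crossing time. -/
theorem ClosedGeodesic.ofReal_integral_le (C : ClosedGeodesic Γ) {I J : Set ℍ}
    {ψ : UnitTangent Γ → ℝ} (hψ : Measurable ψ) (h01 : ∀ q, 0 ≤ ψ q ∧ ψ q ≤ 1)
    (hsupp : ∀ g, ψ (projT Γ g) ≠ 0 → ∃ γ ∈ Γ, γ * g ∈ innerCrossing F I J) :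
    ENNReal.ofReal (∫ q, ψ q ∂C.measure) ≤ volume (C.crossingTimes F I J) := by
  have hm : Measurable fun t => ψ (projT Γ (C.frame * a t)) :=
    hψ.comp (measurable_projT.comp (continuous_const.mul continuous_a).measurable)
  rw [C.integral_measure hψ, ofReal_integral_eq_lintegral_ofReal]
  · calc ∫⁻ t in Ioc 0 C.length, ENNReal.ofReal (ψ (projT Γ (C.frame * a t)))
        ≤ ∫⁻ t in Ioc 0 C.length, (C.crossingTimes F I J).indicator (fun _ => 1) t := by
          refine setLIntegral_mono' measurableSet_Ioc fun t ht => ?_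
          by_cases h : ψ (projT Γ (C.frame * a t)) = 0
          · simp [h]
          · obtain ⟨γ, hγ, hO⟩ := hsupp _ h
            rw [indicator_of_mem]
            · exact ENNReal.ofReal_le_one.mpr (h01 _).2
            · exact ⟨ht, γ⁻¹, Γ.inv_mem hγ, by rwa [inv_inv, mul_assoc]⟩
      _ ≤ 1 * (volume.restrict (Ioc 0 C.length)) (C.crossingTimes F I J) :=
          lintegral_indicator_const_le _ _
      _ ≤ volume (C.crossingTimes F I J) := by
          rw [one_mul]
          exact Measure.restrict_apply_le _ _
  · refine Integrable.of_bound hm.aestronglyMeasurable 1 (ae_of_all _ fun g => ?_)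
    rw [Real.norm_eq_abs, abs_of_nonneg (h01 _).1]
    exact (h01 _).2
  · exact ae_of_all _ fun g => (h01 _).1

theorem totalLength_nonneg [DiscreteTopology Γ] (S : Multiset (ClosedGeodesic Γ)) :
    0 ≤ totalLength S := by
  refine Multiset.sum_nonneg fun x hx => ?_
  obtain ⟨C, -, rfl⟩ := Multiset.mem_map.mp hx
  exact C.length_spec.1.le

/-- Equidistribution gives a lower bound for the time that the geodesics spend in crossings from
`I` to `J`. -/
theorem eventually_crossingTimes [DiscreteTopology Γ] (hF : IsFundamentalPolygon Γ F)
    (hvol : (volume : Measure ℍ) F ≠ ⊤) {C : ℕ → Multiset (ClosedGeodesic Γ)}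
    (hC : Equidistribute F C) {I J : Set ℍ} (hI : IsBoundaryArc F I) (hJ : IsBoundaryArc F J)
    {r : ℝ≥0∞} (hr : r < haarG (innerCrossing F I J)) :
    ∀ᶠ n in atTop, 0 < totalLength (C n) ∧
      r / volume F * ENNReal.ofReal (totalLength (C n)) ≤
        ((C n).map fun γ => volume (γ.crossingTimes F I J)).sum := by
  obtain ⟨ψ, hsm, hcs, hm, h01, hsupp, hint⟩ := exists_testFunction hF hvol
    (isOpen_innerCrossing hF hI hJ) inter_subset_right hr
  have hlim := hC (fun q => ((ψ q : ℝ) : ℂ)) hsm hcs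
  rw [integral_complex_ofReal, haarT_integral _ hm, vol_eq] at hlim
  set m := ∫ g in p ⁻¹' F, ψ (projT Γ g) ∂haarG
  set V := ((volume : Measure ℍ) F).toReal
  have hV : 0 < V := ENNReal.toReal_pos hF.volume_pos.ne' hvol
  let T : ℕ → ℝ := fun n => ((C n).map fun γ => ∫ q, ψ q ∂γ.measure).sum
  have hT : ∀ n, ((C n).map fun γ => ∫ q, ((ψ q : ℝ) : ℂ) ∂γ.measure).sum = (T n : ℂ) := by
    intro n
    have := map_multiset_sum Complex.ofRealHom ((C n).map fun γ => ∫ q, ψ q ∂γ.measure)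
    rw [Multiset.map_map] at this
    simp only [integral_complex_ofReal]
    exact this.symm
  simp only [hT] at hlim
  have hlim' : Tendsto (fun n => T n / totalLength (C n)) atTop (𝓝 (m / V)) := by
    have := (Complex.continuous_re.tendsto _).comp hlim
    refine this.congr' ?_ |>.trans ?_
    · exact Eventually.of_forall fun n => by
        simp only [Function.comp_apply]
        rw [← Complex.ofReal_div, Complex.ofReal_re]
    · rw [← Complex.ofReal_div, Complex.ofReal_re]
  have hrtop : r ≠ ⊤ := hr.ne_top
  have hrm : r.toReal < m := by
    by_contra! hle
    have := ENNReal.ofReal_le_ofReal hle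
    rw [ENNReal.ofReal_toReal hrtop] at this
    exact absurd hint this.not_gt
  have hlt : r.toReal / V < m / V := by gcongr
  filter_upwards [hlim'.eventually (lt_mem_nhds hlt)] with n hn
  have h0 : 0 ≤ r.toReal / V := by positivity
  have hlen : 0 < totalLength (C n) := by
    refine lt_of_le_of_ne (totalLength_nonneg _) fun h => ?_
    rw [← h, div_zero] at hn
    linarith
  refine ⟨hlen, ?_⟩
  rw [lt_div_iff₀ hlen] at hn
  calc r / volume F * ENNReal.ofReal (totalLength (C n))
      = ENNReal.ofReal (r.toReal / V * totalLength (C n)) := by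
        rw [ENNReal.ofReal_mul h0, ENNReal.ofReal_div_of_pos hV, ENNReal.ofReal_toReal hrtop,
          ENNReal.ofReal_toReal hvol]
    _ ≤ ENNReal.ofReal (T n) := ENNReal.ofReal_le_ofReal hn.le
    _ ≤ _ := ofReal_multiset_sum_le _ fun γ => γ.ofReal_integral_le hm h01 hsupp

/-- The ratio of the covered volume to the length is asymptotically at least
`c_{I,J} * d_{I,J}`. -/
theorem crossConst_mul_gapArea_le_liminf [DiscreteTopology Γ] (hF : IsFundamentalPolygon Γ F)
    (hvol : (volume : Measure ℍ) F ≠ ⊤) {C : ℕ → Multiset (ClosedGeodesic Γ)}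
    (hC : Equidistribute F C) {I J : Set ℍ} (hI : IsBoundaryArc F I) (hJ : IsBoundaryArc F J)
    (hIJ : Disjoint I J) :
    crossConst Γ F I J * gapArea F I J ≤
      liminf (fun n => volCovering F (C n) / ENNReal.ofReal (totalLength (C n))) atTop := by
  set X := liminf (fun n => volCovering F (C n) / ENNReal.ofReal (totalLength (C n))) atTop
  set L := maxCrossingLength I J with hL
  rw [crossConst, haarG_crossing hF hI.1 hJ.1, vol_eq, ← hL]
  by_cases hLtop : L = ⊤
  · simp [hLtop]
  by_cases hL0 : L = 0
  · have hempty : innerCrossing F I J = ∅ := by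
      rw [eq_empty_iff_forall_notMem]
      rintro g ⟨⟨l₁, h1, l₂, h2, h3, h4⟩, -⟩
      have : ENNReal.ofReal (l₁ + l₂) ≤ L :=
        le_iSup_of_le g (le_iSup_of_le l₁ (le_iSup_of_le l₂ (le_iSup_of_le ⟨h1, h2, h3, h4⟩ le_rfl)))
      rw [hL0, nonpos_iff_eq_zero, ENNReal.ofReal_eq_zero] at this
      linarith
    simp [hempty]
  set d := gapArea F I J
  have hdtop : d ≠ ⊤ := ((gapArea_le F I J).trans_lt hvol.lt_top).ne
  have hV0 := hF.volume_pos.ne'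
  set V := (volume : Measure ℍ) F
  set k := V⁻¹ * L⁻¹ * d with hk
  have hktop : k ≠ ⊤ := ENNReal.mul_ne_top (ENNReal.mul_ne_top (ENNReal.inv_ne_top.mpr hV0)
    (ENNReal.inv_ne_top.mpr hL0)) hdtop
  have hr : ∀ r < haarG (innerCrossing F I J), r * k ≤ X := by
    intro r hr
    refine le_liminf_of_le (by isBoundedDefault) ?_
    filter_upwards [eventually_crossingTimes hF hvol hC hI hJ hr] with n hn
    obtain ⟨hlen, hn⟩ := hn
    have hl0 : ENNReal.ofReal (totalLength (C n)) ≠ 0 := by simpa using hlen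
    rw [ENNReal.le_div_iff_mul_le (Or.inl hl0) (Or.inl ENNReal.ofReal_ne_top)]
    have h1 := gapArea_mul_crossingTimes_le hF hI hJ hIJ (C n)
    have h2 : d * (r / V * ENNReal.ofReal (totalLength (C n))) ≤ L * volCovering F (C n) := by
      refine le_trans ?_ h1
      gcongr
    calc r * k * ENNReal.ofReal (totalLength (C n))
        = L⁻¹ * (d * (r / V * ENNReal.ofReal (totalLength (C n)))) := by
          rw [hk, div_eq_mul_inv]; ring
      _ ≤ L⁻¹ * (L * volCovering F (C n)) := by gcongr
      _ = volCovering F (C n) := by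
          rw [← mul_assoc, ENNReal.inv_mul_cancel hL0 hLtop, one_mul]
  have e : haarG (innerCrossing F I J) / V / L * d = haarG (innerCrossing F I J) * k := by
    rw [hk, div_eq_mul_inv, div_eq_mul_inv]; ring
  rw [e]
  by_cases hk0 : k = 0
  · simp [hk0]
  rw [← ENNReal.le_div_iff_mul_le (Or.inl hk0) (Or.inl hktop)]
  refine le_of_forall_lt fun r hr' => ?_
  obtain ⟨s, hrs, hs⟩ := exists_between hr'
  exact hrs.trans_le ((ENNReal.le_div_iff_mul_le (Or.inl hk0) (Or.inl hktop)).mpr (hr s hs))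

/-- The lower bound for the covered volume. The sequence `b` is the minimum of the constant and of the
ratio of volume and length; for length zero, where the ratio is meaningless, it is the constant. -/
theorem exists_tendsto_geomConst [DiscreteTopology Γ] (hF : IsFundamentalPolygon Γ F)
    (hvol : (volume : Measure ℍ) F ≠ ⊤) {C : ℕ → Multiset (ClosedGeodesic Γ)}
    (hC : Equidistribute F C) :
    ∃ b : ℕ → ℝ≥0∞, Tendsto b atTop (𝓝 (geomConst Γ F)) ∧
      ∀ n, b n * ENNReal.ofReal (totalLength (C n)) ≤ volCovering F (C n) := by
  classical
  set c := geomConst Γ F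
  let R : ℕ → ℝ≥0∞ := fun n => volCovering F (C n) / ENNReal.ofReal (totalLength (C n))
  have hc : c ≤ liminf R atTop := by
    refine iSup_le fun I => iSup_le fun J => iSup_le fun h => ?_
    exact crossConst_mul_gapArea_le_liminf hF hvol hC h.1 h.2.1 h.2.2
  refine ⟨fun n => if ENNReal.ofReal (totalLength (C n)) = 0 then c else min c (R n), ?_, ?_⟩
  · refine tendsto_order.mpr ⟨fun s hs => ?_, fun s hs => Eventually.of_forall fun n => ?_⟩
    · filter_upwards [eventually_lt_of_lt_liminf (hs.trans_le hc)] with n hn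
      split_ifs
      · exact hs
      · exact lt_min hs hn
    · refine lt_of_le_of_lt ?_ hs
      split_ifs
      · exact le_rfl
      · exact min_le_left _ _
  · intro n
    by_cases h : ENNReal.ofReal (totalLength (C n)) = 0
    · simp [h]
    · simp only [h, if_false]
      calc min c (R n) * ENNReal.ofReal (totalLength (C n))
          ≤ R n * ENNReal.ofReal (totalLength (C n)) := by gcongr; exact min_le_right _ _
        _ = volCovering F (C n) := ENNReal.div_mul_cancel h ENNReal.ofReal_ne_top

end LowerBound

/-! ### A polygon of finite area has a chord -/

theorem range_klein : range klein = {v : ℝ × ℝ | v.1 ^ 2 < v.2} := by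
  ext v
  constructor
  · rintro ⟨z, rfl⟩
    have := z.im_pos
    simp only [klein, mem_ofPred_eq]
    nlinarith
  · intro hv
    have hv' : 0 < v.2 - v.1 ^ 2 := sub_pos.mpr hv
    refine ⟨⟨⟨v.1, √(v.2 - v.1 ^ 2)⟩, Real.sqrt_pos.mpr hv'⟩, Prod.ext rfl ?_⟩
    simp [klein, UpperHalfPlane.im, UpperHalfPlane.re, Real.sq_sqrt hv'.le]

theorem convex_range_klein : Convex ℝ (range klein) := by
  rw [range_klein]
  have : {v : ℝ × ℝ | v.1 ^ 2 < v.2} = {v : ℝ × ℝ | v.1 ∈ univ ∧ v.1 ^ 2 < v.2} := by simp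
  rw [this]
  have h : ConvexOn ℝ univ fun x : ℝ => x ^ 2 := Even.convexOn_pow even_two
  exact h.convex_strict_epigraph

/-- A box resting on the real line has infinite area: the dilation by `2` about the centre of its base
preserves the area and maps a proper subset onto it. -/
theorem volume_box (x₀ : ℝ) {δ : ℝ} (hδ : 0 < δ) :
    (volume : Measure ℍ) {z | |z.re - x₀| < δ ∧ z.im < δ} = ⊤ := by
  have hmeas : ∀ x, IsOpen {z : ℍ | |z.re - x| < δ ∧ z.im < δ} := fun x =>
    (isOpen_lt ((UpperHalfPlane.continuous_re.sub continuous_const).abs) continuous_const).inter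
      (isOpen_lt UpperHalfPlane.continuous_im continuous_const)
  set h : G := toG (⟨⟨x₀, 1⟩, one_pos⟩ : ℍ).toSL2R with hh
  have hre : ∀ z : ℍ, (h • z).re = z.re + x₀ := by
    intro z
    rw [hh, toG_smul, re_smul_SL]
    simp [UpperHalfPlane.coe_toSL2R]
  have him : ∀ z : ℍ, (h • z).im = z.im := by
    intro z
    rw [hh, toG_smul, im_smul_SL]
    simp [UpperHalfPlane.coe_toSL2R]
  have e1 : (fun z : ℍ => h • z) ⁻¹' {z | |z.re - x₀| < δ ∧ z.im < δ} =
      {z | |z.re - 0| < δ ∧ z.im < δ} := by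
    ext z
    simp [hre, him]
  rw [← (smulInvariant_G h).measure_preimage (hmeas x₀).measurableSet.nullMeasurableSet, e1]
  set B := {z : ℍ | |z.re - 0| < δ ∧ z.im < δ} with hB
  have h2 : Real.exp (Real.log 2) = 2 := Real.exp_log two_pos
  have e2 : (fun z : ℍ => a (Real.log 2) • z) ⁻¹' B = {z | |z.re| < δ / 2 ∧ z.im < δ / 2} := by
    ext z
    simp only [hB, mem_preimage, mem_ofPred_eq, re_a_smul, im_a_smul, h2, sub_zero, abs_mul,
      abs_two]
    constructor <;> rintro ⟨h, h'⟩ <;> constructor <;> linarith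
  have hpre := (smulInvariant_G (a (Real.log 2))).measure_preimage
    (hmeas 0).measurableSet.nullMeasurableSet
  rw [← hB, e2] at hpre
  set B' := {z : ℍ | |z.re| < δ / 2 ∧ z.im < δ / 2}
  set U := {z : ℍ | |z.re - 0| < δ ∧ z.im < δ} ∩ {z : ℍ | δ / 2 < z.im}
  have hU : IsOpen U := (hmeas 0).inter (isOpen_lt continuous_const UpperHalfPlane.continuous_im)
  have hUne : U.Nonempty := by
    refine ⟨⟨⟨0, 3 / 4 * δ⟩, show 0 < 3 / 4 * δ by linarith⟩, ⟨?_, ?_⟩, ?_⟩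
    · simpa [UpperHalfPlane.re] using hδ
    · change 3 / 4 * δ < δ; linarith
    · change δ / 2 < 3 / 4 * δ; linarith
  have hdisj : Disjoint B' U := by
    rw [Set.disjoint_left]
    rintro z ⟨-, h1⟩ ⟨-, h2⟩
    exact absurd h1 (not_lt.mpr (le_of_lt h2))
  have hsub : B' ∪ U ⊆ B := by
    rintro z (⟨h1, h2⟩ | ⟨h1, -⟩)
    · refine ⟨by rw [sub_zero]; linarith, by linarith⟩
    · exact h1
  by_contra hne
  have := measure_mono (μ := (volume : Measure ℍ)) hsub
  rw [measure_union hdisj hU.measurableSet, hpre] at this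
  have hpos := hU.measure_pos volume hUne
  exact absurd this (not_le.mpr (ENNReal.lt_add_right hne hpos.ne'))

section Positivity

variable {Γ : Subgroup G} {F : Set ℍ}

/-- A polygon of finite area has two boundary points whose connecting segment meets the polygon.
Otherwise the boundary would be convex, hence contained in a geodesic, and the polygon would
contain a half-plane. -/
theorem IsFundamentalPolygon.exists_chord (hF : IsFundamentalPolygon Γ F)
    (hvol : (volume : Measure ℍ) F ≠ ⊤) :
    ∃ x ∈ frontier F, ∃ y ∈ frontier F, ∃ o ∈ F, klein o ∈ openSegment ℝ (klein x) (klein y) := by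
  by_contra! hno
  have hconv : Convex ℝ (klein '' frontier F) := by
    rw [convex_iff_openSegment_subset]
    rintro _ ⟨z, hz, rfl⟩ _ ⟨w, hw, rfl⟩
    by_cases hne : z = w
    · subst hne
      simpa using ⟨z, hz, rfl⟩
    obtain ⟨g, t, ht, rfl, rfl⟩ := exists_geodesic hne
    intro v hv
    have hv' := hv
    have h := klein_image_geodesic g ht
    rw [a_zero, mul_one] at h
    rw [← h] at hv
    obtain ⟨r, hr, rfl⟩ := hv
    refine mem_image_of_mem _ ?_
    rw [hF.isOpen.frontier_eq]
    refine ⟨?_, fun hrF => hno _ hz _ hw _ hrF hv'⟩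
    refine hF.mem_closure_of_between (s := 0) ?_ (frontier_subset_closure hw) hr
    simpa [a_zero] using frontier_subset_closure hz
  have hdisj : Disjoint (klein '' F) (klein '' frontier F) := by
    rw [disjoint_image_iff klein_injective, Set.disjoint_left]
    exact fun z hz hz' => hF.not_mem_of_mem_frontier hz' hz
  obtain ⟨f, u, hfK, hfC⟩ :=
    geometric_hahn_banach_open hF.convex_klein hF.isOpen_klein hconv hdisj
  -- the open half-plane `f < u` has no boundary point of `F`, so it is contained in `F`
  have hhalf : {z : ℍ | f (klein z) < u} ⊆ F := by
    have hpre : IsPreconnected {z : ℍ | f (klein z) < u} := by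
      rw [← isOpenEmbedding_klein.isInducing.isPreconnected_image]
      have : klein '' {z : ℍ | f (klein z) < u} = {v | f v < u} ∩ range klein := by
        ext v
        constructor
        · rintro ⟨z, hz, rfl⟩
          exact ⟨hz, z, rfl⟩
        · rintro ⟨hv, z, rfl⟩
          exact ⟨z, hv, rfl⟩
      rw [this]
      exact ((convex_halfSpace_lt f.isLinear u).inter convex_range_klein).isPreconnected
    intro z hz
    by_contra hzF
    have hsub : {z : ℍ | f (klein z) < u} ⊆ F ∪ (closure F)ᶜ := by
      intro w hw
      by_contra hwF
      simp only [mem_union, mem_compl_iff, not_or, not_not] at hwF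
      have hwf : w ∈ frontier F := hF.isOpen.frontier_eq ▸ ⟨hwF.2, hwF.1⟩
      exact absurd hw (not_lt.mpr (hfC _ (mem_image_of_mem _ hwf)))
    obtain ⟨w, hw⟩ := hF.isConnected.nonempty
    obtain ⟨v, -, hv1, hv2⟩ := hpre F (closure F)ᶜ hF.isOpen isClosed_closure.isOpen_compl hsub
      ⟨w, hfK _ (mem_image_of_mem _ hw), hw⟩ ⟨z, hz, (hsub hz).resolve_left hzF⟩
    exact hv2 (subset_closure hv1)
  have hflin : ∀ x y : ℝ, f (x, y) = x * f (1, 0) + y * f (0, 1) := by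
    intro x y
    have : ((x, y) : ℝ × ℝ) = x • ((1, 0) : ℝ × ℝ) + y • ((0, 1) : ℝ × ℝ) := by ext <;> simp
    rw [this, map_add, map_smul, map_smul, smul_eq_mul, smul_eq_mul]
  -- the half-plane has a real point in the interior of its boundary at infinity
  obtain ⟨x₀, hx₀⟩ : ∃ x₀ : ℝ, f (x₀, x₀ ^ 2) < u := by
    rcases le_or_gt 0 (f (0, 1)) with hβ | hβ
    · obtain ⟨w, hw⟩ := hF.isConnected.nonempty
      refine ⟨w.re, ?_⟩
      have h1 := hfK _ (mem_image_of_mem _ hw)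
      rw [klein, hflin] at h1
      rw [hflin]
      nlinarith [sq_nonneg w.im]
    · set α := f (1, 0)
      set β := f (0, 1)
      refine ⟨(|α| + |u|) / (-β) + 1, ?_⟩
      rw [hflin]
      set M := (|α| + |u|) / (-β) + 1 with hM
      have hM1 : 1 ≤ M := by
        have : 0 ≤ (|α| + |u|) / (-β) := div_nonneg (by positivity) (by linarith)
        linarith
      have hMβ : M * β = -(|α| + |u|) + β := by
        have := hβ.ne
        rw [hM]
        field_simp
      have h3 : M * α + M ^ 2 * β = M * (α - |α| - |u| + β) := by
        have : M ^ 2 * β = M * (M * β) := by ring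
        rw [this, hMβ]; ring
      rw [h3]
      have h4 : α - |α| - |u| + β < -|u| := by linarith [le_abs_self α]
      have h5 := abs_nonneg u
      have h6 := neg_abs_le u
      nlinarith
  have hcont : Continuous fun v : ℝ × ℝ => f (v.1, v.1 ^ 2 + v.2 ^ 2) := by fun_prop
  have hev : ∀ᶠ v in 𝓝 (x₀, (0 : ℝ)), f (v.1, v.1 ^ 2 + v.2 ^ 2) < u :=
    hcont.continuousAt.eventually (gt_mem_nhds (by simpa using hx₀))
  obtain ⟨δ, hδ, hball⟩ := Metric.eventually_nhds_iff.mp hev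
  refine hvol (top_unique ?_)
  rw [← volume_box x₀ hδ]
  refine measure_mono fun z hz => hhalf ?_
  refine hball (y := (z.re, z.im)) ?_
  rw [Prod.dist_eq, max_lt_iff, Real.dist_eq, Real.dist_eq, sub_zero, abs_of_pos z.im_pos]
  exact hz

/-! ### Arcs cut out of the boundary by sectors -/

/-- The determinant of two vectors in the plane. -/
def planeDet (v w : ℝ × ℝ) : ℝ := v.1 * w.2 - v.2 * w.1

theorem eq_smul_add_smul {d e : ℝ × ℝ} (h : planeDet d e ≠ 0) (v : ℝ × ℝ) :
    v = (planeDet v e / planeDet d e) • d + (planeDet d v / planeDet d e) • e := by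
  simp only [planeDet] at *
  ext <;> simp only [Prod.fst_add, Prod.snd_add, Prod.smul_fst, Prod.smul_snd, smul_eq_mul] <;>
    rw [div_mul_eq_mul_div, div_mul_eq_mul_div, ← add_div, eq_div_iff h] <;> ring

theorem planeDet_coord {d e : ℝ × ℝ} (h : planeDet d e ≠ 0) (s t : ℝ) :
    planeDet (s • d + t • e) e / planeDet d e = s ∧
      planeDet d (s • d + t • e) / planeDet d e = t := by
  simp only [planeDet] at *
  constructor
  · rw [div_eq_iff h]; simp; ring
  · rw [div_eq_iff h]; simp; ring

/-- The boundary points of `F` that lie, in the Klein model, in the open sector with vertex `o`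
spanned by the directions `d - ε e` and `d + ε e`. -/
def sectorArc (F : Set ℍ) (o d e : ℝ × ℝ) (ε : ℝ) : Set ℍ :=
  {z | z ∈ frontier F ∧ 0 < planeDet (klein z - o) e / planeDet d e ∧
    |planeDet d (klein z - o) / planeDet d e| < ε * (planeDet (klein z - o) e / planeDet d e)}

/-- The Klein model of `F`, centred at `o`. -/
def centred (F : Set ℍ) (o : ℝ × ℝ) : Set (ℝ × ℝ) := (fun v => o + v) ⁻¹' (klein '' F)

/-- The point where the ray from `o` in the direction `v` leaves the Klein model of `F`. -/
noncomputable def rayExit (F : Set ℍ) (o v : ℝ × ℝ) : ℝ × ℝ := o + (gauge (centred F o) v)⁻¹ • v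

theorem IsFundamentalPolygon.convex_centred (hF : IsFundamentalPolygon Γ F) (o : ℝ × ℝ) :
    Convex ℝ (centred F o) := hF.convex_klein.translate_preimage_right o

theorem IsFundamentalPolygon.centred_mem_nhds (hF : IsFundamentalPolygon Γ F) {o : ℝ × ℝ}
    (ho : o ∈ klein '' F) : centred F o ∈ 𝓝 0 :=
  (hF.isOpen_klein.preimage (by fun_prop : Continuous fun v : ℝ × ℝ => o + v)).mem_nhds
    (by simpa [centred] using ho)

theorem IsFundamentalPolygon.gauge_eq_one_iff (hF : IsFundamentalPolygon Γ F) {o : ℝ × ℝ}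
    (ho : o ∈ klein '' F) (z : ℍ) : gauge (centred F o) (klein z - o) = 1 ↔ z ∈ frontier F := by
  rw [gauge_eq_one_iff_mem_frontier (hF.convex_centred o) (hF.centred_mem_nhds ho), centred]
  have h := (Homeomorph.addLeft o).isOpenMap.preimage_frontier_eq_frontier_preimage
    (Homeomorph.addLeft o).continuous (klein '' F)
  have h' : frontier ((fun v => o + v) ⁻¹' (klein '' F)) =
      (fun v => o + v) ⁻¹' frontier (klein '' F) := h.symm
  rw [h', mem_preimage, add_sub_cancel, hF.isOpen_klein.frontier_eq, hF.mem_frontier_klein_iff]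

theorem IsFundamentalPolygon.continuous_gauge_centred (hF : IsFundamentalPolygon Γ F) {o : ℝ × ℝ}
    (ho : o ∈ klein '' F) : Continuous (gauge (centred F o)) :=
  continuous_gauge (hF.convex_centred o) (hF.centred_mem_nhds ho)

theorem IsFundamentalPolygon.mem_frontier_of_rayExit (hF : IsFundamentalPolygon Γ F) {o : ℝ × ℝ}
    (ho : o ∈ klein '' F) {v : ℝ × ℝ} (hv : 0 < gauge (centred F o) v) {z : ℍ}
    (hz : klein z = rayExit F o v) : z ∈ frontier F := by
  rw [← hF.gauge_eq_one_iff ho, hz, rayExit, add_sub_cancel_left,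
    gauge_smul_of_nonneg (inv_nonneg.mpr hv.le), smul_eq_mul, inv_mul_cancel₀ hv.ne']

/-- In the Klein model a sector arc is parametrized by the slope of the rays from `o`. -/
theorem image_sectorArc (hF : IsFundamentalPolygon Γ F) {o d e : ℝ × ℝ} {ε : ℝ}
    (ho : o ∈ klein '' F) (hde : planeDet d e ≠ 0)
    (hgauge : ∀ m ∈ Icc (-ε) ε, 0 < gauge (centred F o) (d + m • e))
    (hrange : ∀ m ∈ Icc (-ε) ε, rayExit F o (d + m • e) ∈ range klein) :
    klein '' sectorArc F o d e ε = (fun m : ℝ => rayExit F o (d + m • e)) '' Ioo (-ε) ε := by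
  apply Subset.antisymm
  · rintro _ ⟨z, ⟨hz, h1, h2⟩, rfl⟩
    have hv := eq_smul_add_smul hde (klein z - o)
    set s := planeDet (klein z - o) e / planeDet d e
    set t := planeDet d (klein z - o) / planeDet d e
    rw [abs_lt] at h2
    have hm : t / s ∈ Ioo (-ε) ε := by
      rw [mem_Ioo, lt_div_iff₀ h1, div_lt_iff₀ h1]
      exact ⟨by linarith [h2.1], h2.2⟩
    refine ⟨t / s, hm, ?_⟩
    have hv' : klein z - o = s • (d + (t / s) • e) := by
      rw [smul_add, smul_smul, mul_div_cancel₀ _ h1.ne']; exact hv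
    have hg := (hF.gauge_eq_one_iff ho z).mpr hz
    rw [hv', gauge_smul_of_nonneg h1.le, smul_eq_mul] at hg
    have hinv : (gauge (centred F o) (d + (t / s) • e))⁻¹ = s := inv_eq_of_mul_eq_one_left hg
    simp only [rayExit]
    rw [hinv, ← hv', add_sub_cancel]
  · rintro _ ⟨m, hm, rfl⟩
    have hmI : m ∈ Icc (-ε) ε := Ioo_subset_Icc_self hm
    obtain ⟨z, hz⟩ := hrange m hmI
    have hg := hgauge m hmI
    refine ⟨z, ⟨hF.mem_frontier_of_rayExit ho hg hz, ?_⟩, hz⟩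
    have hzo : klein z - o = (gauge (centred F o) (d + m • e))⁻¹ • d +
        ((gauge (centred F o) (d + m • e))⁻¹ * m) • e := by
      rw [hz, rayExit, add_sub_cancel_left, smul_add, smul_smul]
    obtain ⟨c1, c2⟩ := planeDet_coord hde (gauge (centred F o) (d + m • e))⁻¹
      ((gauge (centred F o) (d + m • e))⁻¹ * m)
    have hpos := inv_pos.mpr hg
    rw [hzo, c1, c2]
    refine ⟨hpos, ?_⟩
    rw [abs_mul, abs_of_pos hpos, mul_comm]
    exact mul_lt_mul_of_pos_right (abs_lt.mpr hm) hpos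

/-- If the closed sector leaves the polygon inside the hyperbolic plane, its open part cuts out a
boundary arc, which has an endpoint on the ray in the direction `d + ε e` and lies in a compact set. -/
theorem isBoundaryArc_sectorArc (hF : IsFundamentalPolygon Γ F) {o d e : ℝ × ℝ} {ε : ℝ}
    (hε : 0 < ε) (ho : o ∈ klein '' F) (hde : planeDet d e ≠ 0)
    (hgauge : ∀ m ∈ Icc (-ε) ε, 0 < gauge (centred F o) (d + m • e))
    (hrange : ∀ m ∈ Icc (-ε) ε, rayExit F o (d + m • e) ∈ range klein) :
    IsBoundaryArc F (sectorArc F o d e ε) ∧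
      (∃ z ∈ closure (sectorArc F o d e ε) \ sectorArc F o d e ε,
        klein z = rayExit F o (d + ε • e)) ∧
      ∃ Q : Set ℍ, IsCompact Q ∧ sectorArc F o d e ε ⊆ Q := by
  have himg := image_sectorArc hF ho hde hgauge hrange
  have hg := hF.continuous_gauge_centred ho
  have hcont : ContinuousOn (fun m : ℝ => rayExit F o (d + m • e)) (Icc (-ε) ε) := by
    have h1 : Continuous fun m : ℝ => d + m • e := by fun_prop
    exact continuousOn_const.add (((hg.comp h1).continuousOn.inv₀
      fun m hm => (hgauge m hm).ne').smul h1.continuousOn)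
  have hk := continuous_klein
  refine ⟨⟨fun z hz => hz.1, ⟨?_, ?_⟩, ?_⟩, ?_, ?_⟩
  · rw [← image_nonempty (f := klein), himg]
    exact ⟨_, mem_image_of_mem _ (show (0 : ℝ) ∈ Ioo (-ε) ε from ⟨by linarith, hε⟩)⟩
  · rw [← isOpenEmbedding_klein.isInducing.isPreconnected_image, himg]
    exact isPreconnected_Ioo.image _ (hcont.mono Ioo_subset_Icc_self)
  · refine ⟨{z | 0 < planeDet (klein z - o) e / planeDet d e ∧
      |planeDet d (klein z - o) / planeDet d e| < ε * (planeDet (klein z - o) e / planeDet d e)},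
      ?_, ?_⟩
    · have c1 : Continuous fun z : ℍ => planeDet (klein z - o) e / planeDet d e := by
        unfold planeDet; fun_prop
      have c2 : Continuous fun z : ℍ => planeDet d (klein z - o) / planeDet d e := by
        unfold planeDet; fun_prop
      exact (isOpen_lt continuous_const c1).inter (isOpen_lt c2.abs (continuous_const.mul c1))
    · ext z
      exact ⟨fun h => ⟨h.2, h.1⟩, fun h => ⟨h.2, h.1⟩⟩
  · have hεI : ε ∈ Icc (-ε) ε := ⟨by linarith, le_rfl⟩
    obtain ⟨z, hz⟩ := hrange ε hεI
    refine ⟨z, ⟨?_, ?_⟩, hz⟩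
    · rw [isOpenEmbedding_klein.isInducing.closure_eq_preimage_closure_image, mem_preimage, himg, hz]
      refine ContinuousWithinAt.mem_closure_image (f := fun m : ℝ => rayExit F o (d + m • e))
        ((hcont ε hεI).mono Ioo_subset_Icc_self) ?_
      rw [closure_Ioo (by linarith : -ε ≠ ε)]
      exact hεI
    · rintro ⟨-, h1, h2⟩
      have hzo : klein z - o = (gauge (centred F o) (d + ε • e))⁻¹ • d +
          ((gauge (centred F o) (d + ε • e))⁻¹ * ε) • e := by
        rw [hz, rayExit, add_sub_cancel_left, smul_add, smul_smul]
      obtain ⟨c1, c2⟩ := planeDet_coord hde (gauge (centred F o) (d + ε • e))⁻¹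
        ((gauge (centred F o) (d + ε • e))⁻¹ * ε)
      rw [hzo, c1, c2, mul_comm] at h2
      exact absurd h2 (not_lt.mpr (le_abs_self _))
  · refine ⟨klein ⁻¹' ((fun m : ℝ => rayExit F o (d + m • e)) '' Icc (-ε) ε), ?_, ?_⟩
    · rw [isOpenEmbedding_klein.isInducing.isCompact_preimage_iff]
      · exact isCompact_Icc.image_of_continuousOn hcont
      · rintro _ ⟨m, hm, rfl⟩
        exact hrange m hm
    · rw [← image_subset_iff, himg]
      exact image_mono Ioo_subset_Icc_self

theorem dist_p_geodesic (g : G) (s t : ℝ) : dist (p (g * a s)) (p (g * a t)) = |s - t| := by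
  obtain ⟨A, rfl⟩ := toG_surjective g
  rw [p_mul, p_mul, toG_smul, toG_smul, dist_smul, UpperHalfPlane.dist_of_re_eq
    (by rw [re_p_a, re_p_a]), im_p_a, im_p_a, Real.log_exp, Real.log_exp, Real.dist_eq]

theorem maxCrossingLength_ne_top {I J Q R : Set ℍ} (hQ : IsCompact Q) (hR : IsCompact R)
    (hI : I ⊆ Q) (hJ : J ⊆ R) : maxCrossingLength I J ≠ ⊤ := by
  have hb := (hQ.union hR).isBounded
  refine ne_top_of_le_ne_top (ENNReal.ofReal_ne_top (r := Metric.diam (Q ∪ R))) ?_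
  refine iSup_le fun g => iSup_le fun l₁ => iSup_le fun l₂ => iSup_le fun h => ?_
  obtain ⟨h1, h2, h3, h4⟩ := h
  refine ENNReal.ofReal_le_ofReal ?_
  have := Metric.dist_le_diam_of_mem hb (Or.inr (hJ h4)) (Or.inl (hI h3))
  rw [dist_p_geodesic, abs_of_pos (by linarith)] at this
  linarith

end Positivity

/-! ### Positivity of the constant -/

section Positivity

variable {Γ : Subgroup G} {F : Set ℍ}

theorem planeDet_neg_left (d e : ℝ × ℝ) : planeDet (-d) e = -planeDet d e := by
  simp only [planeDet, Prod.fst_neg, Prod.snd_neg]; ring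

/-- If the ray in the direction `d` leaves the polygon at a point of the hyperbolic plane (and not
at infinity), then so do the neighbouring rays, at nearby points. -/
theorem eventually_rayExit (hF : IsFundamentalPolygon Γ F) {o d : ℝ × ℝ} (e : ℝ × ℝ)
    (ho : o ∈ klein '' F) (hd : 0 < gauge (centred F o) d)
    (hr : rayExit F o d ∈ range klein) :
    (∀ᶠ m : ℝ in 𝓝 0, 0 < gauge (centred F o) (d + m • e) ∧
      rayExit F o (d + m • e) ∈ range klein) ∧
    ContinuousAt (fun m : ℝ => rayExit F o (d + m • e)) 0 := by
  have h1 : Continuous fun m : ℝ => d + m • e := by fun_prop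
  have hg := (hF.continuous_gauge_centred ho).comp h1
  have hc : ContinuousAt (fun m : ℝ => rayExit F o (d + m • e)) 0 := by
    unfold rayExit
    refine continuousAt_const.add ((hg.continuousAt.inv₀ ?_).smul h1.continuousAt)
    simpa using hd.ne'
  refine ⟨(hg.continuousAt.eventually (lt_mem_nhds (by simpa using hd))).and
    (hc.eventually (isOpenEmbedding_klein.isOpen_range.mem_nhds ?_)), hc⟩
  simpa using hr

/-- The chord from `z₀` to `z₁` along the left sides of the two opposite sectors has both sector arcs
on its right. -/
theorem sectorArc_gap (hF : IsFundamentalPolygon Γ F) {o d e z₀ z₁ : ℝ × ℝ} {ε α β : ℝ}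
    (ho : o ∈ klein '' F) (hde : 0 < planeDet d e) (hε : 0 < ε) (hα : 0 < α) (hβ : 0 < β)
    (hz₀ : z₀ = o + α • (-d + ε • e)) (hz₁ : z₁ = o + β • (d + ε • e))
    (hz₀f : z₀ ∈ closure (klein '' F) \ klein '' F) (hz₁f : z₁ ∈ closure (klein '' F) \ klein '' F)
    {w : ℍ} (hw : w ∈ sectorArc F o (-d) e ε ∪ sectorArc F o d e ε) :
    orient z₀ z₁ (klein w) ≤ 0 := by
  have hwf : w ∈ frontier F := hw.elim (fun h => h.1) (fun h => h.1)
  have hv := eq_smul_add_smul hde.ne' (klein w - o)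
  set s := planeDet (klein w - o) e / planeDet d e
  set t := planeDet d (klein w - o) / planeDet d e
  have hst : |t| < ε * |s| := by
    rcases hw with h | h
    · obtain ⟨-, h1, h2⟩ := h
      simp only [planeDet_neg_left, div_neg, neg_div, neg_neg] at h1 h2
      rwa [abs_of_neg (by linarith : s < 0)]
    · obtain ⟨-, h1, h2⟩ := h
      rwa [abs_of_pos h1]
  by_contra! hlt
  have hneg : orient z₀ z₁ o < 0 := by
    have : orient z₀ z₁ o = -(2 * (α * β * (ε * planeDet d e))) := by
      rw [hz₀, hz₁]
      simp only [orient, planeDet]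
      simp
      ring
    rw [this]
    have : 0 < α * β * (ε * planeDet d e) := by positivity
    linarith
  have hne : z₀ ≠ z₁ := by
    rintro h
    rw [h] at hneg
    simp [orient] at hneg
  -- the segment from the centre `o` to `w` crosses the chord from `z₀` to `z₁`
  set A := orient z₀ z₁ o
  set B := orient z₀ z₁ (klein w)
  have hAB : 0 < B - A := by linarith
  set r := -A / (B - A) with hr
  have hr0 : 0 < r := div_pos (by linarith) hAB
  have hr1 : r < 1 := by rw [hr, div_lt_one hAB]; linarith
  have hq : orient z₀ z₁ (AffineMap.lineMap o (klein w) r) = 0 := by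
    rw [orient_lineMap]
    change (1 - -A / (B - A)) * A + -A / (B - A) * B = 0
    field_simp
    ring
  have hqK := openSegment_subset_of_mem_closure hF.convex_klein hF.isOpen_klein ho
    (hF.mem_frontier_klein_iff.mpr hwf).1 (lineMap_mem_openSegment hr0 hr1)
  have hqs := (chord_of_line_meets hF.convex_klein hF.isOpen_klein hz₀f hz₁f hne hqK hq).1
  rw [openSegment_eq_image_lineMap] at hqs
  obtain ⟨θ, ⟨hθ0, hθ1⟩, hθ⟩ := hqs
  have hcomb : ((1 - θ) * -α + θ * β) • d + ((1 - θ) * (α * ε) + θ * (β * ε)) • e =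
      (r * s) • d + (r * t) • e := by
    have h1 : AffineMap.lineMap z₀ z₁ θ - o =
        ((1 - θ) * -α + θ * β) • d + ((1 - θ) * (α * ε) + θ * (β * ε)) • e := by
      rw [hz₀, hz₁]
      ext <;> simp [AffineMap.lineMap_apply_module] <;> ring
    have h2 : AffineMap.lineMap o (klein w) r - o = (r * s) • d + (r * t) • e := by
      rw [AffineMap.lineMap_apply_module', add_sub_cancel_right, hv, smul_add, smul_smul, smul_smul]
    rw [← h1, ← h2, hθ]
  obtain ⟨c1, c2⟩ := planeDet_coord hde.ne' ((1 - θ) * -α + θ * β)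
    ((1 - θ) * (α * ε) + θ * (β * ε))
  obtain ⟨c3, c4⟩ := planeDet_coord hde.ne' (r * s) (r * t)
  rw [hcomb] at c1 c2
  have e1 : r * s = (1 - θ) * -α + θ * β := c3.symm.trans c1
  have e2 : r * t = ((1 - θ) * α + θ * β) * ε := by
    rw [c4.symm.trans c2]; ring
  have h3 : r * t ≤ r * |t| := by gcongr; exact le_abs_self t
  have h4 : r * |t| < r * (ε * |s|) := by gcongr
  have h5 : r * (ε * |s|) = ε * |(1 - θ) * -α + θ * β| := by
    rw [← e1, abs_mul, abs_of_pos hr0]; ring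
  have h6 : |(1 - θ) * -α + θ * β| ≤ (1 - θ) * α + θ * β := by
    have p1 : 0 < (1 - θ) * α := mul_pos (by linarith) hα
    have p2 : 0 < θ * β := mul_pos hθ0 hβ
    rw [abs_le]
    constructor <;> linarith
  have h7 : ε * |(1 - θ) * -α + θ * β| ≤ ε * ((1 - θ) * α + θ * β) := by gcongr
  linarith

/-- The positivity of the constant: around the endpoints of a chord of the polygon there are small
boundary arcs, cut out by thin sectors with vertex on the chord; the chord itself runs from one arc
to the other, and the gap on its left cuts off a set of positive area. -/
theorem geomConst_pos (hF : IsFundamentalPolygon Γ F) (hvol : (volume : Measure ℍ) F ≠ ⊤) :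
    0 < geomConst Γ F := by
  obtain ⟨x, hx, y, hy, o, ho, hoxy⟩ := hF.exists_chord hvol
  have hoK : klein o ∈ klein '' F := mem_image_of_mem _ ho
  have hxy : x ≠ y := by
    rintro rfl
    rw [openSegment_same, mem_singleton_iff] at hoxy
    exact hF.not_mem_of_mem_frontier hx (klein_injective hoxy ▸ ho)
  set X := klein x with hX
  set Y := klein y with hY
  set O := klein o
  set d := Y - O with hd
  have hoxy' := hoxy
  rw [openSegment_eq_image_lineMap] at hoxy
  obtain ⟨s, ⟨hs0, hs1⟩, hs⟩ := hoxy
  -- `X - O = - c d`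
  set c := s / (1 - s) with hc
  have hc0 : 0 < c := div_pos hs0 (by linarith)
  have h1s : (1 : ℝ) - s ≠ 0 := by linarith
  have hXO : X - O = c • (-d) := by
    rw [hd, ← hs, hc]
    ext <;> simp [AffineMap.lineMap_apply_module] <;> field_simp <;> ring
  have hd0 : d ≠ 0 := by
    intro h0
    have hYO : Y = O := sub_eq_zero.mp h0
    have : X = O := by
      rw [h0, neg_zero, smul_zero] at hXO; exact sub_eq_zero.mp hXO
    exact hxy (klein_injective (this.trans hYO.symm))
  set e : ℝ × ℝ := (-d.2, d.1) with he
  have hde : 0 < planeDet d e := by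
    simp only [planeDet, he]
    have : d.1 ≠ 0 ∨ d.2 ≠ 0 := by
      by_contra! h
      exact hd0 (Prod.ext h.1 h.2)
    rcases this with h | h
    · have := sq_pos_of_ne_zero h
      nlinarith [sq_nonneg d.2]
    · have := sq_pos_of_ne_zero h
      nlinarith [sq_nonneg d.1]
  have hde' : planeDet (-d) e ≠ 0 := by
    rw [planeDet_neg_left]; linarith
  -- the rays in the directions `d` and `- d` exit at `Y` and `X`
  have hgY : gauge (centred F O) d = 1 := (hF.gauge_eq_one_iff hoK y).mpr hy
  have hgX : gauge (centred F O) (-d) = c⁻¹ := by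
    have h := (hF.gauge_eq_one_iff hoK x).mpr hx
    rw [← hX, hXO, gauge_smul_of_nonneg hc0.le, smul_eq_mul] at h
    exact eq_inv_of_mul_eq_one_right h
  have hEY : rayExit F O d = Y := by
    rw [rayExit, hgY, inv_one, one_smul, hd, add_sub_cancel]
  have hEX : rayExit F O (-d) = X := by
    rw [rayExit, hgX, inv_inv, ← hXO, add_sub_cancel]
  obtain ⟨evY, ctY⟩ := eventually_rayExit hF e hoK (d := d) (by rw [hgY]; exact one_pos)
    (by rw [hEY]; exact ⟨y, rfl⟩)
  obtain ⟨evX, ctX⟩ := eventually_rayExit hF e hoK (d := -d) (by rw [hgX]; positivity)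
    (by rw [hEX]; exact ⟨x, rfl⟩)
  -- a point of the polygon strictly to the left of the chord from `X` to `Y`
  obtain ⟨f, hfF, hfleft⟩ : ∃ f ∈ F, 0 < orient X Y (klein f) := by
    have hcont : Continuous fun τ : ℝ => O + τ • e := by fun_prop
    have hev : ∀ᶠ τ : ℝ in 𝓝 0, O + τ • e ∈ klein '' F :=
      hcont.continuousAt.eventually (hF.isOpen_klein.mem_nhds (by simpa using hoK))
    obtain ⟨τ, ⟨f, hfF, hf⟩, hτ⟩ := ((hev.filter_mono nhdsWithin_le_nhds).and
      (self_mem_nhdsWithin : Ioi (0 : ℝ) ∈ 𝓝[>] 0)).exists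
    refine ⟨f, hfF, ?_⟩
    have hXe : X = O + c • (-d) := by rw [← hXO, add_sub_cancel]
    have hYe : Y = O + d := by rw [hd, add_sub_cancel]
    have : orient X Y (klein f) = (1 + c) * τ * planeDet d e := by
      rw [hf, hXe, hYe]
      simp only [orient, planeDet]
      simp
      ring
    rw [this]
    have hτ' : (0 : ℝ) < τ := hτ
    positivity
  have evL : ∀ᶠ m : ℝ in 𝓝 0,
      0 < orient (rayExit F O (-d + m • e)) (rayExit F O (d + m • e)) (klein f) := by
    have hcont : ContinuousAt (fun m : ℝ =>
        orient (rayExit F O (-d + m • e)) (rayExit F O (d + m • e)) (klein f)) 0 := by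
      have hor : Continuous fun q : (ℝ × ℝ) × (ℝ × ℝ) => orient q.1 q.2 (klein f) := by
        unfold orient; fun_prop
      exact hor.continuousAt.comp (f := fun m : ℝ =>
        (rayExit F O (-d + m • e), rayExit F O (d + m • e))) (ctX.prodMk ctY)
    refine hcont.eventually (lt_mem_nhds ?_)
    simpa [hEX, hEY] using hfleft
  obtain ⟨δ, hδ, hball⟩ := Metric.eventually_nhds_iff.mp (evX.and (evY.and evL))
  set ε := δ / 2 with hε'
  have hε : 0 < ε := by linarith
  have hin : ∀ m ∈ Icc (-ε) ε, dist m 0 < δ := by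
    intro m hm
    rw [Real.dist_eq, sub_zero]
    have := abs_le.mpr hm
    linarith
  have hεI : ε ∈ Icc (-ε) ε := ⟨by linarith, le_rfl⟩
  obtain ⟨hIarc, ⟨z₀, hz₀, hz₀e⟩, Q, hQ, hIQ⟩ := isBoundaryArc_sectorArc hF hε hoK hde'
    (fun m hm => (hball (hin m hm)).1.1) (fun m hm => (hball (hin m hm)).1.2)
  obtain ⟨hJarc, ⟨z₁, hz₁, hz₁e⟩, R, hR, hJR⟩ := isBoundaryArc_sectorArc hF hε hoK hde.ne'
    (fun m hm => (hball (hin m hm)).2.1.1) (fun m hm => (hball (hin m hm)).2.1.2)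
  set I := sectorArc F O (-d) e ε
  set J := sectorArc F O d e ε
  have hIJ : Disjoint I J := by
    rw [Set.disjoint_left]
    rintro w ⟨-, h1, -⟩ ⟨-, h2, -⟩
    rw [planeDet_neg_left, div_neg] at h1
    linarith
  obtain ⟨⟨hgα, -⟩, ⟨hgβ, -⟩, hleft⟩ := hball (hin ε hεI)
  have hz₀f : z₀ ∈ frontier F := hF.mem_frontier_of_rayExit hoK hgα hz₀e
  have hz₁f : z₁ ∈ frontier F := hF.mem_frontier_of_rayExit hoK hgβ hz₁e
  rw [← hz₀e, ← hz₁e] at hleft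
  have hz01 : z₀ ≠ z₁ := by
    rintro rfl
    simp [orient] at hleft
  -- the gap chord from `z₀` to `z₁` cuts off a neighbourhood of `f`
  have hgap : 0 < gapArea F I J := by
    obtain ⟨h, t, ht, hh0, hh1⟩ := exists_geodesic hz01
    have hchord : IsGapChord F I J h := by
      refine ⟨hh0 ▸ hz₀, ⟨t, ht, hh1 ▸ hz₁⟩, ?_⟩
      rw [Set.disjoint_left]
      rintro w ⟨-, hwl⟩ hw
      have hwl' := (re_neg_iff h ht w).mp hwl
      rw [a_zero, mul_one, hh0, hh1] at hwl'
      exact absurd hwl' (not_lt.mpr (sectorArc_gap hF hoK hde hε (inv_pos.mpr hgα)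
        (inv_pos.mpr hgβ) hz₀e hz₁e (hF.mem_frontier_klein_iff.mpr hz₀f)
        (hF.mem_frontier_klein_iff.mpr hz₁f) hw))
    have hU : IsOpen ({w : ℍ | 0 < orient (klein z₀) (klein z₁) (klein w)} ∩ F) :=
      (isOpen_lt continuous_const ((continuous_orient _ _).comp continuous_klein)).inter hF.isOpen
    refine (hU.measure_pos volume ⟨f, hleft, hfF⟩).trans_le ?_
    refine le_trans (measure_mono ?_)
      (le_iSup₂_of_le (f := fun g (_ : IsGapChord F I J g) => volume (leftSide g ∩ F)) h hchord le_rfl)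
    rintro w ⟨hw, hwF⟩
    refine ⟨?_, hwF⟩
    rw [mem_leftSide_iff h ht, a_zero, mul_one, hh0, hh1]
    exact le_of_lt hw
  -- the chord from `x` to `y` through `o` is a crossing
  have hxI : x ∈ I := by
    refine ⟨hx, ?_⟩
    have hXO' : klein x - O = c • (-d) + (0 : ℝ) • e := by rw [zero_smul, add_zero]; exact hXO
    obtain ⟨c1, c2⟩ := planeDet_coord hde' c 0
    rw [hXO', c1, c2, abs_zero]
    exact ⟨hc0, mul_pos hε hc0⟩
  have hyJ : y ∈ J := by
    refine ⟨hy, ?_⟩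
    have hYO' : klein y - O = (1 : ℝ) • d + (0 : ℝ) • e := by
      rw [zero_smul, add_zero, one_smul]
    obtain ⟨c1, c2⟩ := planeDet_coord hde.ne' 1 0
    rw [hYO', c1, c2, abs_zero]
    exact ⟨one_pos, mul_pos hε one_pos⟩
  have hne : (innerCrossing F I J).Nonempty := by
    obtain ⟨g, t, ht, hg0, hg1⟩ := exists_geodesic hxy
    have h := klein_image_geodesic g ht
    rw [a_zero, mul_one, hg0, hg1] at h
    rw [← hX, ← hY] at h
    rw [← h] at hoxy'
    obtain ⟨r, ⟨hr0, hrt⟩, hr⟩ := hoxy'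
    have hr' := klein_injective hr
    refine ⟨g * a r, ⟨r, hr0, t - r, by linarith, ?_, ?_⟩, ?_⟩
    · rw [p_a_add, add_neg_cancel, a_zero, mul_one, hg0]
      exact hxI
    · rw [p_a_add, add_sub_cancel, hg1]
      exact hyJ
    · rw [mem_preimage, hr']
      exact ho
  have hhaar : 0 < haarG (crossing I J) :=
    (haarG_pos_of_isOpen (isOpen_innerCrossing hF hIarc hJarc) hne).trans_le
      (measure_mono inter_subset_left)
  have hcross : 0 < crossConst Γ F I J := by
    rw [crossConst, vol_eq]
    exact ENNReal.div_pos (ENNReal.div_pos hhaar.ne' hvol).ne'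
      (maxCrossingLength_ne_top hQ hR hIQ hJR)
  refine (ENNReal.mul_pos hcross.ne' hgap.ne').trans_le ?_
  exact le_iSup_of_le I (le_iSup_of_le J (le_iSup_of_le ⟨hIarc, hJarc, hIJ⟩ le_rfl))

end Positivity

end PaintLeft

theorem proposition4p5 (Γ : Subgroup PaintLeft.G) (hdisc : DiscreteTopology Γ)
    (hcof : PaintLeft.IsCofinite Γ) (F : Set UpperHalfPlane)
    (hF : PaintLeft.IsFundamentalPolygon Γ F)
    (C : ℕ → Multiset (PaintLeft.ClosedGeodesic Γ)) (hC : PaintLeft.Equidistribute F C) :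
    0 < PaintLeft.geomConst Γ F ∧
      ∃ b : ℕ → ENNReal, Filter.Tendsto b Filter.atTop (nhds (PaintLeft.geomConst Γ F)) ∧
        ∀ n, b n * ENNReal.ofReal (PaintLeft.totalLength (C n)) ≤
          PaintLeft.volCovering F (C n) := by
  have hvol := (hF.volume_lt_top hcof).ne
  exact ⟨PaintLeft.geomConst_pos hF hvol, PaintLeft.exists_tendsto_geomConst hF hvol hC⟩
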